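/- Let $\mathcal X\subset\mathbb R^d$ be bounded with $L_2$-diameter $D$, and let $\mathcal Y$ be a finite label set. There are constants $C>0$ and $s>2$, depending only on $\mathcal X$ and $\mathcal Y$, such that the following holds. Let $\mathcal S_1,\dots,\mathcal S_T$ (sources) and $\mathcal T$ (target) be probability laws on $\mathcal X\times\mathcal Y$ with $\mathcal T(y)=0$ whenever $\mathcal S_t(y)=0$ for some $t$, and put $\alpha_t(y)=\mathcal T(y)/\mathcal S_t(y)$ (with $0/0=0$), $d^{\sup}_\infty=\max_{t,y}\alpha_t(y)$, $\mathcal Y_+=\{y:\mathcal T(y)>0\}$. Let $\ell:\mathbb R\to[0,L_{\max}]$ be $L$-Lipschitz, and let $\mathcal H$ be a family of functions $h:\mathcal X\times\mathcal Y\to\mathbb R$ such that $h(\cdot,y)$ is $K$-Lipschitz for every $y$. Write $R_{\mathcal T}(h)=\mathbb E_{(x,y)\sim\mathcal T}\,\ell(h(x,y))$. Let $\hat{\mathcal S}_t$ ($t=1,\dots,T$) and $\hat{\mathcal T}$ be independent samples of $N_{\mathcal S_t}\ge1$ and $N_{\mathcal T}\ge1$ i.i.d. draws from $\mathcal S_t$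 and $\mathcal T$. Let $N^y_{\mathcal S_t}$, $N^y_{\mathcal T}$ be the numbers of sample points with label $y$, $\hat{\mathcal T}(y)=N^y_{\mathcal T}/N_{\mathcal T}$, and let $\hat{\mathcal S}_t(x|Y=y)$, $\hat{\mathcal T}(x|Y=y)$ be the uniform laws on the sample points with label $y$. Put $N=\sum_tN_{\mathcal S_t}$, $\beta_t=N_{\mathcal S_t}/N$ and $\hat R^{a}_{\mathcal S_t}(h)=\frac1{N_{\mathcal S_t}}\sum_{(x_i,y_i)\in\hat{\mathcal S}_t}a(y_i)\ell(h(x_i,y_i))$. Let $W_1$ be the Wasserstein-1 distance with the $L_2$-distance as cost. Let $0<\delta<1$ and let $\boldsymbol\lambda$ be a vector with $\boldsymbol\lambda[t]\ge0$, $\sum_t\boldsymbol\lambda[t]=1$. Then with probability at least $1-4\delta$, simultaneously for all $h\in\mathcal H$ and all $\hat\alpha_1,\dots,\hat\alpha_T:\mathcal Y\to\mathbb R$ (in particular for any estimates computed from the data, such as the empirical label ratios), $$ \begin{aligned} R_{\mathcal T}(h)\le{}&\sum_t\boldsymbol\lambda[t]\hat R^{\hat\alpha_t}_{\mathcal S_t}(h)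 +L_{\max}d^{\sup}_\infty\sqrt{\sum_{t=1}^T\frac{\boldsymbol\lambda[t]^2}{\beta_t}}\sqrt{\frac{\log(1/\delta)}{2N}}\\ &+LK\sum_t\boldsymbol\lambda[t]\,\mathbb E_{y\sim\hat{\mathcal T}(y)}W_1\big(\hat{\mathcal T}(x|Y=y)\,\|\,\hat{\mathcal S}_t(x|Y=y)\big) +L_{\max}\sup_t\|\alpha_t-\hat\alpha_t\|_2+\mathrm{Comp}, \end{aligned} $$ where $$ \mathrm{Comp}=2\sup_t\mathcal R_t+LK\Big[\sup_{t,\;y\in\mathcal Y_+}\kappa_{t,y}+C_{\max}\Big(\sqrt{\tfrac{2\log(2|\mathcal Y|)}{N_{\mathcal T}}}+\sqrt{\tfrac{\log(T/\delta)}{2N_{\mathcal T}}}\Big)\Big], $$ $\mathcal R_t=\mathbb E_{\hat{\mathcal S}_t}\mathbb E_\sigma\sup_{h\in\mathcal H}\frac1{N_{\mathcal S_t}}\sum_i\sigma_i\alpha_t(y_i)\ell(h(x_i,y_i))$ is the Rademacher complexity ($\sigma_i$ independent uniform signs), $$ \kappa_{t,y}=C(N^y_{\mathcal S_t})^{-1/s}+C(N^y_{\mathcal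 T})^{-1/s}+D\sqrt{\tfrac12\log\tfrac{2T|\mathcal Y|}{\delta}}\Big(\sqrt{\tfrac1{N^y_{\mathcal S_t}}}+\sqrt{\tfrac1{N^y_{\mathcal T}}}\Big), $$ and $C_{\max}=\sup_{t,\;y\in\mathcal Y_+}W_1(\hat{\mathcal T}(x|Y=y)\|\hat{\mathcal S}_t(x|Y=y))$. If a label $y\in\mathcal Y_+$ is missing from one of the samples, $\kappa$ is read as $+\infty$ and the bound says nothing. Moreover, for fixed $\mathcal S_t,\mathcal T,\ell,\mathcal H,\delta$ and a fixed value $C_{\max}\ge0$, $\mathrm{Comp}$ is a non-increasing function of the sample sizes $N_{\mathcal S_t}\ge1$, $N_{\mathcal T}\ge1$ and the class counts $N^y_{\mathcal S_t}$, $N^y_{\mathcal T}$ (those with $y\in\mathcal Y_+$ being at least $1$). -/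

import Mathlib

open MeasureTheory
open scoped ENNReal NNReal

noncomputable section

namespace LabelShift

/-- The probability that a law on `X × Y` gives to the label `y`, written `D(y)`. -/
def labelMass {X Y : Type*} [MeasurableSpace X] [MeasurableSpace Y]
    (D : Measure (X × Y)) (y : Y) : ℝ :=
  D.real {p | p.2 = y}

/-- The true label-distribution ratio `α(y) = Q(y) / S(y)` of target `Q` and source `S`. -/
def labelRatio {X Y : Type*} [MeasurableSpace X] [MeasurableSpace Y]
    (S Q : Measure (X × Y)) (y : Y) : ℝ :=
  labelMass Q y / labelMass S y

/-- The expected risk `R_D(h) = E_{(x,y) ∼ D} ℓ(h(x,y))`. -/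
def risk {X Y : Type*} [MeasurableSpace X] [MeasurableSpace Y]
    (D : Measure (X × Y)) (ℓ : ℝ → ℝ) (h : X → Y → ℝ) : ℝ :=
  ∫ p, ℓ (h p.1 p.2) ∂D

/-- The empirical `a`-weighted risk `(1/n) ∑ a(yᵢ) ℓ(h(xᵢ,yᵢ))` of the sample `z`. -/
def empRisk {X Y : Type*} {n : ℕ} (z : Fin n → X × Y) (a : Y → ℝ)
    (ℓ : ℝ → ℝ) (h : X → Y → ℝ) : ℝ :=
  (1 / (n : ℝ)) * ∑ i, a (z i).2 * ℓ (h (z i).1 (z i).2)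

/-- The number of points of the sample `z` whose label is `y`. -/
def classCount {X Y : Type*} [DecidableEq Y] {n : ℕ} (z : Fin n → X × Y) (y : Y) : ℕ :=
  (Finset.univ.filter fun i => (z i).2 = y).card

/-- The empirical conditional law of `x` given `Y = y`: the uniform law on the points of the
sample `z` that carry the label `y`. (It is the zero measure if there is no such point.) -/
def empCond {X Y : Type*} [MeasurableSpace X] [DecidableEq Y] {n : ℕ}
    (z : Fin n → X × Y) (y : Y) : Measure X :=
  ((classCount z y : ℝ≥0∞))⁻¹ •
    ∑ i ∈ Finset.univ.filter (fun i => (z i).2 = y), Measure.dirac (z i).1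

/-- The Wasserstein-1 distance with the distance of `X` as cost: the infimum of
`∫ dist(x, x') dγ` over all couplings `γ` of `μ` and `ν`. -/
def wasserstein1 {X : Type*} [MetricSpace X] [MeasurableSpace X] (μ ν : Measure X) : ℝ≥0∞ :=
  ⨅ γ ∈ {γ : Measure (X × X) | γ.map Prod.fst = μ ∧ γ.map Prod.snd = ν},
    ∫⁻ p, edist p.1 p.2 ∂γ

/-- `W₁` between the empirical class-`y` conditionals of a target sample and a source sample. -/
def empW1 {X Y : Type*} [MetricSpace X] [MeasurableSpace X] [DecidableEq Y] {n m : ℕ}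
    (zQ : Fin m → X × Y) (zS : Fin n → X × Y) (y : Y) : ℝ :=
  (wasserstein1 (empCond zQ y) (empCond zS y)).toReal

/-- The Rademacher complexity, for samples of size `n` from `S`, of the weighted losses
`(x,y) ↦ a(y) ℓ(h(x,y))`, `h ∈ H`:
`E_{z ∼ Sⁿ} E_σ sup_{h ∈ H} (1/n) ∑ σᵢ a(yᵢ) ℓ(h(xᵢ,yᵢ))`, with `σ` uniform on `{-1,1}ⁿ`. -/
def rademacher {X Y : Type*} [MeasurableSpace X] [MeasurableSpace Y]
    (S : Measure (X × Y)) (a : Y → ℝ) (ℓ : ℝ → ℝ) (H : Set (X → Y → ℝ)) (n : ℕ) : ℝ :=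
  ∫ z, (1 / 2 ^ n : ℝ) * ∑ σ : Fin n → Bool,
      ⨆ h : H, (1 / (n : ℝ)) * ∑ i, (if σ i then (1 : ℝ) else -1) *
        (a (z i).2 * ℓ (h.1 (z i).1 (z i).2))
    ∂(Measure.pi fun _ : Fin n => S)

/-- `κ` for one source and one label: the deviation of the empirical from the true conditional
laws in `W₁`, with `k` source points and `m` target points of that label, number of sources `T`,
number of labels `c`, diameter `D` of the input space, and constants `C`, `s`. -/
def kappa (C s D : ℝ) (T c : ℕ) (δ : ℝ) (k m : ℕ) : ℝ :=
  C * (k : ℝ) ^ (-(1 / s)) + C * (m : ℝ) ^ (-(1 / s)) +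
    D * √((1 / 2) * Real.log (2 * T * c / δ)) * (√(1 / (k : ℝ)) + √(1 / (m : ℝ)))

/-- The term `Comp`. Here `LK` is the product of the two Lipschitz constants, `N t` and `M` are the
sizes of the samples from source `t` and from the target, `k t y` and `m y` are the numbers of
points with label `y` in them. Labels that have probability zero under the target play no role. -/
def comp {X Y : Type*} [MeasurableSpace X] [MeasurableSpace Y] [Fintype Y] {T : ℕ}
    (S : Fin T → Measure (X × Y)) (Q : Measure (X × Y)) (ℓ : ℝ → ℝ) (H : Set (X → Y → ℝ))
    (LK C s D Cmax : ℝ) (N : Fin T → ℕ) (M : ℕ) (k : Fin T → Y → ℕ) (m : Y → ℕ) (δ : ℝ) : ℝ :=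
  2 * (⨆ t, rademacher (S t) (labelRatio (S t) Q) ℓ H (N t)) +
    LK * ((⨆ p : Fin T × {y : Y // 0 < labelMass Q y},
        kappa C s D T (Fintype.card Y) δ (k p.1 p.2) (m p.2)) +
      Cmax * (√(2 * Real.log (2 * Fintype.card Y) / M) + √(Real.log (T / δ) / (2 * M))))

/-- The largest empirical `W₁` distance between target and source class conditionals. -/
def maxEmpW1 {X Y : Type*} [MetricSpace X] [MeasurableSpace X] [MeasurableSpace Y]
    [DecidableEq Y] {T : ℕ} {N : Fin T → ℕ} {M : ℕ} (Q : Measure (X × Y))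
    (zS : ∀ t, Fin (N t) → X × Y) (zQ : Fin M → X × Y) : ℝ :=
  ⨆ p : Fin T × {y : Y // 0 < labelMass Q y}, empW1 zQ (zS p.1) p.2

/-- The joint law of the data: all samples are independent, the `t`-th one consists of `N t`
i.i.d. draws from `S t` and the last one of `M` i.i.d. draws from `Q`. -/
def dataLaw {X Y : Type*} [MeasurableSpace X] [MeasurableSpace Y] {T : ℕ}
    (S : Fin T → Measure (X × Y)) (Q : Measure (X × Y)) (N : Fin T → ℕ) (M : ℕ) :
    Measure ((∀ t, Fin (N t) → X × Y) × (Fin M → X × Y)) :=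
  (Measure.pi fun t => Measure.pi fun _ : Fin (N t) => S t).prod
    (Measure.pi fun _ : Fin M => Q)

end LabelShift

end

noncomputable section

namespace LabelShift

open ProbabilityTheory

set_option linter.unusedSectionVars false

/-! Put `f(x,y) = ℓ(h(x,y))`, which is `LK`-Lipschitz in `x`. Splitting over labels, the target risk
is `∑ T(y) ∫ f(·,y) dT(·|y)`. The `α_t`-weighted risk on source `t` is `∑ T(y) ∫ f(·,y) dS_t(·|y)`,
because `S_t(y) α_t(y) = T(y)`. The two differ only through the class conditionals. For each class
one passes from the target conditional to its empirical version, then to the empirical source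
conditional, then to the source conditional. The middle leg costs `W₁` by the easy half of
Kantorovich duality, and the outer legs cost the uniform deviation `lipDev` over 1-Lipschitz
functions. Replacing `T(y)` by the observed frequency costs `Cmax` times `labelDev`. This is
`integral_sub_integral_ratio_le`. Replacing the weighted source risks by empirical ones costs
`uniformDev`, and replacing `α_t` by arbitrary weights is a deterministic estimate
(`empRisk_le_add`).

The random quantities `lipDev`, `labelDev`, `uniformDev` involve neither `h` nor the estimated
weights, so one event serves all of them simultaneously. Each concentrates around its mean by
McDiarmid's inequality (`hasSubgaussianMGF_pi_of_bounded_differences`). The means are bounded by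
symmetrization (`integral_uniformDev_le`), by a grid of cubes giving the rate `k^(-1/(2d+3))`
(`integral_lipDev_le`), and by a variance bound (`integral_labelDev_le`). Random class sizes are
handled by conditioning on the vector of labels (`measure_classDev_gt_le`).

The mean label deviation `|Y|/√M` is absorbed into the constant `C` of `κ` (`kappa_add_le`), which
is possible because `Cmax ≤ D` and `C` may depend on `X` and `Y`. The failure probabilities add up
to `3δ`.

In the monotonicity claim only the Rademacher term needs an argument: an average over `n + 1` points
is the mean of its leave-one-out averages (`radComplexity_antitone`). -/

/-! ### McDiarmid's inequality. -/

/-- Tensorization step for sub-Gaussian moment generating functions: a function of two independent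
variables that oscillates by at most `c` in the first one. -/
lemma hasSubgaussianMGF_prod {A B : Type*} [MeasurableSpace A] [MeasurableSpace B]
    (μ : Measure A) (ν : Measure B) [IsProbabilityMeasure μ] [IsProbabilityMeasure ν]
    {F : A × B → ℝ} (hF : Measurable F) {b : ℝ} (hb : ∀ p, |F p| ≤ b) {c C : ℝ≥0} (m : ℝ)
    (hc : ∀ x x' w, F (x, w) - F (x', w) ≤ c)
    (h : HasSubgaussianMGF (fun w => (∫ x, F (x, w) ∂μ) - m) C ν) :
    HasSubgaussianMGF (fun p => F p - m) ((c / 2) ^ 2 + C) (μ.prod ν) := by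
  have hA : Nonempty A := by
    by_contra hA
    rw [not_nonempty_iff] at hA
    exact IsProbabilityMeasure.ne_zero μ (Measure.eq_zero_of_isEmpty μ)
  have hint : ∀ t : ℝ, Integrable (fun p => Real.exp (t * (F p - m))) (μ.prod ν) := fun t =>
    integrable_exp_mul_of_mem_Icc (a := -b - m) (b := b - m) (by fun_prop)
      (ae_of_all _ fun p => by
        have := abs_le.1 (hb p)
        constructor <;> linarith)
  refine ⟨hint, fun t => ?_⟩
  -- Hoeffding's lemma on each fibre: for fixed `w` the values lie in an interval of length `c`
  -- starting at the infimum, and this interval may depend on `w`.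
  have hsec : ∀ w, HasSubgaussianMGF (fun x => F (x, w) - ∫ x, F (x, w) ∂μ) ((c / 2) ^ 2) μ := by
    intro w
    have := hasSubgaussianMGF_of_mem_Icc (μ := μ) (X := fun x => F (x, w))
      (a := ⨅ x, F (x, w)) (b := (⨅ x, F (x, w)) + c)
      (hF.comp (measurable_id.prodMk measurable_const)).aemeasurable
      (ae_of_all _ fun x => by
        refine ⟨ciInf_le ⟨-b, ?_⟩ x, ?_⟩
        · rintro _ ⟨y, rfl⟩
          exact (abs_le.1 (hb _)).1
        · have : F (x, w) - c ≤ ⨅ x, F (x, w) := le_ciInf fun x' => by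
            have := hc x x' w
            linarith
          linarith)
    simpa using this
  have hle : ∀ w, ∫ x, Real.exp (t * (F (x, w) - m)) ∂μ ≤
      Real.exp (((c / 2) ^ 2 : ℝ≥0) * t ^ 2 / 2) *
        Real.exp (t * ((∫ x, F (x, w) ∂μ) - m)) := by
    intro w
    have := (hsec w).mgf_le t
    rw [mgf] at this
    calc ∫ x, Real.exp (t * (F (x, w) - m)) ∂μ
        = ∫ x, Real.exp (t * (F (x, w) - ∫ x, F (x, w) ∂μ)) *
            Real.exp (t * ((∫ x, F (x, w) ∂μ) - m)) ∂μ := by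
          congr 1 with x
          rw [← Real.exp_add]
          ring_nf
      _ ≤ _ := by
          rw [integral_mul_const]
          gcongr
  calc mgf (fun p => F p - m) (μ.prod ν) t
      = ∫ w, ∫ x, Real.exp (t * (F (x, w) - m)) ∂μ ∂ν := by
        rw [mgf, integral_prod_symm _ (hint t)]
    _ ≤ ∫ w, Real.exp (((c / 2) ^ 2 : ℝ≥0) * t ^ 2 / 2) *
        Real.exp (t * ((∫ x, F (x, w) ∂μ) - m)) ∂ν :=
        integral_mono (hint t).integral_prod_right ((h.integrable_exp_mul t).const_mul _) hle
    _ ≤ Real.exp (((c / 2) ^ 2 : ℝ≥0) * t ^ 2 / 2) * Real.exp (C * t ^ 2 / 2) := by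
        rw [integral_const_mul]
        gcongr
        exact h.mgf_le t
    _ = _ := by
        rw [← Real.exp_add]
        push_cast
        ring_nf

/-- McDiarmid's inequality, in moment generating function form. -/
theorem hasSubgaussianMGF_pi_of_bounded_differences {Z : Type*} [MeasurableSpace Z] {n : ℕ}
    (ν : Fin n → Measure Z) [∀ i, IsProbabilityMeasure (ν i)] {f : (Fin n → Z) → ℝ}
    (hf : Measurable f) {b : ℝ} (hb : ∀ z, |f z| ≤ b) (c : Fin n → ℝ≥0)
    (hc : ∀ i z x, f (Function.update z i x) - f z ≤ c i) :
    HasSubgaussianMGF (fun z => f z - ∫ z, f z ∂(Measure.pi ν)) (∑ i, (c i / 2) ^ 2)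
      (Measure.pi ν) := by
  induction n with
  | zero =>
    have : (fun z => f z - ∫ z, f z ∂(Measure.pi ν)) = fun _ => 0 := by
      funext z
      rw [Measure.pi_of_empty ν z, integral_dirac' _ _ hf.stronglyMeasurable, sub_self]
    simp [this]
  | succ n ih =>
    set e := MeasurableEquiv.piFinSuccAbove (fun _ : Fin (n + 1) => Z) 0
    have he := measurePreserving_piFinSuccAbove ν 0
    set F : Z × (Fin n → Z) → ℝ := fun p => f (e.symm p) with hF
    have hes : ∀ x w, e.symm (x, w) = Fin.cons x w := fun x w => by
      funext i
      refine Fin.cases ?_ (fun j => ?_) i <;> simp [e]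
    have hFe : ∀ z, f (e.symm (e z)) = f z := fun z => congrArg f (e.symm_apply_apply z)
    have hFm : Measurable F := hf.comp e.symm.measurable
    have hFb : ∀ p, |F p| ≤ b := fun p => hb _
    have hmean : ∫ z, f z ∂(Measure.pi ν) =
        ∫ w, ∫ x, F (x, w) ∂(ν 0) ∂(Measure.pi fun j : Fin n => ν (Fin.succAbove 0 j)) := by
      rw [← integral_prod_symm F (Integrable.of_bound hFm.aestronglyMeasurable b
        (ae_of_all _ hFb)), ← he.map_eq, integral_map_equiv]
      exact integral_congr_ae (ae_of_all _ fun z => (hFe z).symm)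
    have hFint : ∀ w, Integrable (fun x => F (x, w)) (ν 0) := fun w =>
      Integrable.of_bound
        (hFm.comp (measurable_id.prodMk measurable_const)).aestronglyMeasurable b
        (ae_of_all _ fun x => hFb _)
    -- Integrating out coordinate 0 preserves the bounded differences in the remaining coordinates.
    have hbar := ih (fun j : Fin n => ν (Fin.succAbove 0 j)) (f := fun w => ∫ x, F (x, w) ∂(ν 0))
      (hFm.stronglyMeasurable.integral_prod_left').measurable
      (fun w => by
        have := norm_integral_le_of_norm_le_const (μ := ν 0) (f := fun x => F (x, w)) (C := b)
          (ae_of_all _ fun x => hFb _)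
        simpa using this)
      (fun j => c j.succ)
      (fun i w x => by
        rw [← integral_sub (hFint _) (hFint _)]
        calc _ ≤ ∫ _, (c i.succ : ℝ) ∂(ν 0) := by
              refine integral_mono ((hFint _).sub (hFint _)) (integrable_const _) fun y => ?_
              have := hc i.succ (Fin.cons y w) x
              simpa [hF, hes, Fin.cons_update] using this
          _ = c i.succ := by simp)
    rw [← hmean] at hbar
    have := hasSubgaussianMGF_prod (ν 0) (Measure.pi fun j : Fin n => ν (Fin.succAbove 0 j)) hFm hFb
      (c := c 0) _ (fun x x' w => by
        have := hc 0 (Fin.cons x' w) x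
        simpa [hF, hes] using this) hbar
    rw [Fin.sum_univ_succ]
    rw [← he.map_eq] at this
    have := HasSubgaussianMGF.of_map he.measurable.aemeasurable this
    exact this.congr (ae_of_all _ fun z => congrArg (· - _) (hFe z))

/-- The Chernoff bound solved for the threshold. The strict inequality matters when `c = 0`: then `f
= 0` almost surely and the threshold is `0`. -/
lemma HasSubgaussianMGF.measure_gt_le {Ω : Type*} [MeasurableSpace Ω] {μ : Measure Ω}
    [IsProbabilityMeasure μ] {f : Ω → ℝ} {c : ℝ≥0} (h : HasSubgaussianMGF f c μ) {δ : ℝ}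
    (hδ : 0 < δ) (hδ1 : δ ≤ 1) :
    μ {ω | √(2 * c * Real.log (1 / δ)) < f ω} ≤ ENNReal.ofReal δ := by
  rcases eq_or_ne c 0 with rfl | hc
  · have h0 := h.ae_eq_zero_of_hasSubgaussianMGF_zero
    refine le_of_eq_of_le ?_ zero_le
    refine measure_eq_zero_iff_ae_notMem.2 ?_
    filter_upwards [h0] with ω hω
    simp [hω]
  · have hlog : 0 ≤ Real.log (1 / δ) := Real.log_nonneg (by rw [le_div_iff₀ hδ]; linarith)
    have := h.measure_ge_le (Real.sqrt_nonneg (2 * c * Real.log (1 / δ)))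
    rw [Real.sq_sqrt (by positivity), neg_div, mul_div_cancel_left₀ _ (by positivity), one_div,
      Real.log_inv, neg_neg, Real.exp_log hδ, ← Real.log_inv, ← one_div] at this
    have hsub : {ω | √(2 * c * Real.log (1 / δ)) < f ω} ⊆ {ω | √(2 * c * Real.log (1 / δ)) ≤ f ω} :=
      fun ω hω => Set.mem_ofPred.2 (le_of_lt (Set.mem_ofPred.1 hω))
    refine (measure_mono hsub).trans ?_
    rw [← ofReal_measureReal]
    exact ENNReal.ofReal_le_ofReal this

/-- The index set may be uncountable; a bounded supremum of continuous functions is lower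
semicontinuous, hence Borel. -/
lemma measurable_iSup_of_continuous {ι W : Type*} [TopologicalSpace W] [MeasurableSpace W]
    [OpensMeasurableSpace W] {F : ι → W → ℝ} (hF : ∀ i, Continuous (F i)) {b : ℝ}
    (hb : ∀ i w, F i w ≤ b) : Measurable fun w => ⨆ i, F i w :=
  (lowerSemicontinuous_ciSup (fun w => ⟨b, by rintro _ ⟨i, rfl⟩; exact hb i w⟩)
    fun i => (hF i).lowerSemicontinuous).measurable

lemma abs_iSup_le {ι : Type*} {F : ι → ℝ} {b : ℝ} (hb0 : 0 ≤ b) (hb : ∀ i, |F i| ≤ b) :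
    |⨆ i, F i| ≤ b := by
  rcases isEmpty_or_nonempty ι with h | h
  · simpa using hb0
  · rw [abs_le]
    have i := h.some
    exact ⟨(abs_le.1 (hb i)).1.trans (le_ciSup (f := F)
      ⟨b, by rintro _ ⟨j, rfl⟩; exact (abs_le.1 (hb j)).2⟩ i),
      ciSup_le fun j => (abs_le.1 (hb j)).2⟩

/-! ### Rademacher complexity: monotonicity in the sample size, symmetrization, concentration. -/

section Rademacher

variable {ι Z : Type*}

/-- The supremum over the family `g` of the averages of `g h (zᵢ)` with signs `σ`. -/
def signedSup (g : ι → Z → ℝ) {n : ℕ} (σ : Fin n → Bool) (z : Fin n → Z) : ℝ :=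
  ⨆ h, (1 / (n : ℝ)) * ∑ i, (if σ i then (1 : ℝ) else -1) * g h (z i)

lemma abs_signed_average_le {g : Z → ℝ} {B : ℝ} (hg : ∀ p, |g p| ≤ B) (hB : 0 ≤ B) {n : ℕ}
    (σ : Fin n → Bool) (z : Fin n → Z) :
    |(1 / (n : ℝ)) * ∑ i, (if σ i then (1 : ℝ) else -1) * g (z i)| ≤ B := by
  have h1 : |∑ i, (if σ i then (1 : ℝ) else -1) * g (z i)| ≤ n * B := by
    calc _ ≤ ∑ i : Fin n, |(if σ i then (1 : ℝ) else -1) * g (z i)| :=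
          Finset.abs_sum_le_sum_abs _ _
      _ ≤ ∑ _i : Fin n, B := by
          refine Finset.sum_le_sum fun i _ => ?_
          split_ifs <;> simpa using hg (z i)
      _ = n * B := by simp
  rw [abs_mul, abs_of_nonneg (by positivity : (0 : ℝ) ≤ 1 / n)]
  rcases Nat.eq_zero_or_pos n with rfl | hn
  · simpa using hB
  · calc _ ≤ 1 / (n : ℝ) * (n * B) := by gcongr
      _ = B := by field_simp

lemma abs_signedSup_le {g : ι → Z → ℝ} {B : ℝ} (hg : ∀ h p, |g h p| ≤ B) (hB : 0 ≤ B) {n : ℕ}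
    (σ : Fin n → Bool) (z : Fin n → Z) : |signedSup g σ z| ≤ B :=
  abs_iSup_le hB fun h => abs_signed_average_le (hg h) hB σ z

lemma le_signedSup {g : ι → Z → ℝ} {B : ℝ} (hg : ∀ h p, |g h p| ≤ B) (hB : 0 ≤ B) {n : ℕ}
    (σ : Fin n → Bool) (z : Fin n → Z) (h : ι) :
    (1 / (n : ℝ)) * ∑ i, (if σ i then (1 : ℝ) else -1) * g h (z i) ≤ signedSup g σ z :=
  le_ciSup (f := fun h => (1 / (n : ℝ)) * ∑ i, (if σ i then (1 : ℝ) else -1) * g h (z i))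
    ⟨B, by rintro _ ⟨j, rfl⟩; exact (abs_le.1 (abs_signed_average_le (hg j) hB σ z)).2⟩ h

/-- The signed average over `n + 1` points is the mean of its `n + 1` leave-one-out averages, and
the supremum of a mean is at most the mean of the suprema. -/
lemma signedSup_succ_le {g : ι → Z → ℝ} {B : ℝ} (hg : ∀ h p, |g h p| ≤ B) (hB : 0 ≤ B) {n : ℕ} (hn : 0 < n)
    (σ : Fin (n + 1) → Bool) (z : Fin (n + 1) → Z) :
    signedSup g σ z ≤ (1 / (n + 1 : ℝ)) *
      ∑ j : Fin (n + 1), signedSup g (fun i => σ (j.succAbove i)) fun i => z (j.succAbove i) := by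
  rcases isEmpty_or_nonempty ι with h | h
  · simp [signedSup]
  refine ciSup_le fun h => ?_
  set x : Fin (n + 1) → ℝ := fun i => (if σ i then (1 : ℝ) else -1) * g h (z i) with hx
  -- Each index is left out exactly once, so it is counted `n` times.
  have hsum : ∑ j : Fin (n + 1), ∑ i, x (j.succAbove i) = n * ∑ i, x i := by
    have : ∀ j : Fin (n + 1), ∑ i, x (j.succAbove i) = (∑ i, x i) - x j := fun j => by
      rw [Fin.sum_univ_succAbove x j]
      ring
    simp_rw [this, Finset.sum_sub_distrib]
    simp
    ring
  calc (1 / ((n + 1 : ℕ) : ℝ)) * ∑ i, x i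
      = (1 / (n + 1 : ℝ)) * ∑ j : Fin (n + 1), (1 / (n : ℝ)) * ∑ i, x (j.succAbove i) := by
        rw [← Finset.mul_sum, hsum]
        push_cast
        field_simp
    _ ≤ _ := by
        gcongr with j
        exact le_signedSup hg hB (fun i => σ (j.succAbove i)) (fun i => z (j.succAbove i)) h

lemma abs_average_le {g : Z → ℝ} {B : ℝ} (hg : ∀ p, |g p| ≤ B) (hB : 0 ≤ B) {n : ℕ}
    (z : Fin n → Z) : |(1 / (n : ℝ)) * ∑ i, g (z i)| ≤ B := by
  simpa using abs_signed_average_le hg hB (fun _ => true) z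

variable [TopologicalSpace Z] [SecondCountableTopology Z] [MeasurableSpace Z] [BorelSpace Z]

lemma measurable_signedSup {g : ι → Z → ℝ} (hc : ∀ h, Continuous (g h)) {B : ℝ}
    (hg : ∀ h p, |g h p| ≤ B) (hB : 0 ≤ B) {n : ℕ} (σ : Fin n → Bool) :
    Measurable (signedSup g σ) :=
  measurable_iSup_of_continuous (fun h => by have := hc h; fun_prop) fun h z =>
    (abs_le.1 (abs_signed_average_le (hg h) hB σ z)).2

/-- The Rademacher complexity of a family of functions on `Z`, for samples of size `n`. -/
def radComplexity (μ : Measure Z) (g : ι → Z → ℝ) (n : ℕ) : ℝ :=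
  ∫ z, (1 / 2 ^ n : ℝ) * ∑ σ : Fin n → Bool, signedSup g σ z ∂(Measure.pi fun _ : Fin n => μ)

variable (μ : Measure Z) [IsProbabilityMeasure μ] {g : ι → Z → ℝ} {B : ℝ}

lemma integrable_signedSup (hc : ∀ h, Continuous (g h)) (hg : ∀ h p, |g h p| ≤ B) (hB : 0 ≤ B)
    {n : ℕ} (σ : Fin n → Bool) : Integrable (signedSup g σ) (Measure.pi fun _ : Fin n => μ) :=
  Integrable.of_bound (measurable_signedSup hc hg hB σ).aestronglyMeasurable B
    (ae_of_all _ (abs_signedSup_le hg hB σ))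

lemma radComplexity_eq (hc : ∀ h, Continuous (g h)) (hg : ∀ h p, |g h p| ≤ B) (hB : 0 ≤ B)
    (n : ℕ) : radComplexity μ g n = (1 / 2 ^ n : ℝ) *
      ∑ σ : Fin n → Bool, ∫ z, signedSup g σ z ∂(Measure.pi fun _ : Fin n => μ) := by
  rw [radComplexity, integral_const_mul,
    integral_finsetSum _ fun σ _ => integrable_signedSup μ hc hg hB σ]

lemma integral_comp_succAbove {n : ℕ} (j : Fin (n + 1)) (f : (Fin n → Z) → ℝ) (hf : Measurable f) :
    ∫ z, f (fun i => z (j.succAbove i)) ∂(Measure.pi fun _ : Fin (n + 1) => μ) =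
      ∫ z, f z ∂(Measure.pi fun _ : Fin n => μ) := by
  have h := (measurePreserving_piFinSuccAbove (fun _ : Fin (n + 1) => μ) j)
  have h2 := (measurePreserving_snd (μ := μ) (ν := Measure.pi fun _ : Fin n => μ)).comp h
  rw [← h2.map_eq, integral_map h2.measurable.aemeasurable hf.aestronglyMeasurable]
  rfl

lemma radComplexity_succ_le (hc : ∀ h, Continuous (g h)) (hg : ∀ h p, |g h p| ≤ B) (hB : 0 ≤ B)
    {n : ℕ} (hn : 0 < n) : radComplexity μ g (n + 1) ≤ radComplexity μ g n := by
  rw [radComplexity_eq μ hc hg hB, radComplexity_eq μ hc hg hB]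
  set A : (Fin n → Bool) → ℝ := fun τ =>
    ∫ z, signedSup g τ z ∂(Measure.pi fun _ : Fin n => μ) with hA
  have h1 : ∀ σ : Fin (n + 1) → Bool,
      ∫ z, signedSup g σ z ∂(Measure.pi fun _ : Fin (n + 1) => μ) ≤
        (1 / (n + 1 : ℝ)) * ∑ j : Fin (n + 1), A fun i => σ (j.succAbove i) := by
    intro σ
    have hint : ∀ j : Fin (n + 1), Integrable (fun z : Fin (n + 1) → Z =>
        signedSup g (fun i => σ (j.succAbove i)) fun i => z (j.succAbove i))
        (Measure.pi fun _ : Fin (n + 1) => μ) := fun j =>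
      Integrable.of_bound ((measurable_signedSup hc hg hB _).comp
        (by fun_prop)).aestronglyMeasurable B (ae_of_all _ fun z => abs_signedSup_le hg hB _ _)
    calc _ ≤ ∫ z, (1 / (n + 1 : ℝ)) * ∑ j : Fin (n + 1),
          signedSup g (fun i => σ (j.succAbove i)) (fun i => z (j.succAbove i))
          ∂(Measure.pi fun _ : Fin (n + 1) => μ) :=
          integral_mono (integrable_signedSup μ hc hg hB σ)
            ((integrable_finsetSum _ fun j _ => hint j).const_mul _)
            fun z => signedSup_succ_le hg hB hn σ z
      _ = _ := by
          rw [integral_const_mul, integral_finsetSum _ fun j _ => hint j]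
          congr 2 with j
          exact integral_comp_succAbove μ j _ (measurable_signedSup hc hg hB _)
  -- Deleting the `j`-th sign is two-to-one, which turns the normalization `2^(n+1)` into `2^n`.
  have h2 : ∀ j : Fin (n + 1), ∑ σ : Fin (n + 1) → Bool, A (fun i => σ (j.succAbove i)) =
      2 * ∑ τ, A τ := by
    intro j
    rw [← (Fin.insertNthEquiv (fun _ => Bool) j).sum_comp, Fintype.sum_prod_type]
    simp
  calc _ ≤ (1 / 2 ^ (n + 1) : ℝ) * ∑ σ : Fin (n + 1) → Bool,
        (1 / (n + 1 : ℝ)) * ∑ j : Fin (n + 1), A fun i => σ (j.succAbove i) := by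
        gcongr with σ
        exact h1 σ
    _ = _ := by
        rw [← Finset.mul_sum, Finset.sum_comm]
        simp_rw [h2]
        simp only [Finset.sum_const, Finset.card_univ, Fintype.card_fin, nsmul_eq_mul]
        push_cast
        field_simp
        ring

/-- Rademacher complexities do not increase with the sample size. -/
lemma radComplexity_antitone (hc : ∀ h, Continuous (g h)) (hg : ∀ h p, |g h p| ≤ B) (hB : 0 ≤ B)
    {n m : ℕ} (hn : 0 < n) (hnm : n ≤ m) : radComplexity μ g m ≤ radComplexity μ g n := by
  induction m, hnm using Nat.le_induction with
  | base => exact le_rfl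
  | succ m hm ih => exact (radComplexity_succ_le μ hc hg hB (hn.trans_le hm)).trans ih

/-- The pairs (sample point, ghost point) are i.i.d. with an exchangeable law, so any subset of the
pairs may be swapped. This introduces the signs in the symmetrization. -/
lemma measurePreserving_swap_coordinates {n : ℕ} (σ : Fin n → Bool) :
    MeasurePreserving (fun p : (Fin n → Z) × (Fin n → Z) =>
      ((fun i => if σ i then p.1 i else p.2 i), fun i => if σ i then p.2 i else p.1 i))
      ((Measure.pi fun _ : Fin n => μ).prod (Measure.pi fun _ : Fin n => μ))
      ((Measure.pi fun _ : Fin n => μ).prod (Measure.pi fun _ : Fin n => μ)) := by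
  have he := measurePreserving_arrowProdEquivProdArrow Z Z (Fin n) (fun _ => μ) (fun _ => μ)
  have hs : MeasurePreserving
      (fun (q : Fin n → Z × Z) i => if σ i then q i else (q i).swap)
      (Measure.pi fun _ => μ.prod μ) (Measure.pi fun _ => μ.prod μ) :=
    measurePreserving_pi (f := fun i (r : Z × Z) => if σ i then r else r.swap)
      (fun _ : Fin n => μ.prod μ) (fun _ : Fin n => μ.prod μ) fun i => by
      cases σ i
      · simpa using Measure.measurePreserving_swap
      · simpa using! MeasurePreserving.id (μ.prod μ)
  convert! (he.comp hs).comp he.symm using 1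
  funext p
  refine Prod.ext (funext fun i => ?_) (funext fun i => ?_)
  · change (if σ i then p.1 i else p.2 i) = (if σ i then (p.1 i, p.2 i) else (p.1 i, p.2 i).swap).1
    split_ifs <;> rfl
  · change (if σ i then p.2 i else p.1 i) = (if σ i then (p.1 i, p.2 i) else (p.1 i, p.2 i).swap).2
    split_ifs <;> rfl

/-- The one-sided uniform deviation of the sample means from the means over a family `g`. -/
def uniformDev (g : ι → Z → ℝ) {n : ℕ} (z : Fin n → Z) : ℝ :=
  ⨆ h, ((∫ p, g h p ∂μ) - (1 / (n : ℝ)) * ∑ i, g h (z i))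

lemma abs_integral_le_of_abs_le {W : Type*} [MeasurableSpace W] (ν : Measure W)
    [IsProbabilityMeasure ν] {f : W → ℝ} (hf : ∀ p, |f p| ≤ B) : |∫ p, f p ∂ν| ≤ B := by
  simpa using norm_integral_le_of_norm_le_const (μ := ν) (f := f) (C := B) (ae_of_all _ hf)

lemma abs_deviation_le {g : Z → ℝ} (hg : ∀ p, |g p| ≤ B) (hB : 0 ≤ B) {n : ℕ} (z : Fin n → Z) :
    |(∫ p, g p ∂μ) - (1 / (n : ℝ)) * ∑ i, g (z i)| ≤ 2 * B := by
  have h1 := abs_average_le hg hB z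
  have h2 := abs_integral_le_of_abs_le μ hg
  rw [abs_le] at *
  constructor <;> linarith

lemma abs_uniformDev_le (hg : ∀ h p, |g h p| ≤ B) (hB : 0 ≤ B) {n : ℕ} (z : Fin n → Z) :
    |uniformDev μ g z| ≤ 2 * B :=
  abs_iSup_le (by positivity) fun h => abs_deviation_le μ (hg h) hB z

lemma le_uniformDev (hg : ∀ h p, |g h p| ≤ B) (hB : 0 ≤ B) {n : ℕ} (z : Fin n → Z) (h : ι) :
    (∫ p, g h p ∂μ) - (1 / (n : ℝ)) * ∑ i, g h (z i) ≤ uniformDev μ g z :=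
  le_ciSup (f := fun h => (∫ p, g h p ∂μ) - (1 / (n : ℝ)) * ∑ i, g h (z i))
    ⟨2 * B, by rintro _ ⟨j, rfl⟩; exact (abs_le.1 (abs_deviation_le μ (hg j) hB z)).2⟩ h

lemma measurable_uniformDev (hc : ∀ h, Continuous (g h)) (hg : ∀ h p, |g h p| ≤ B) (hB : 0 ≤ B)
    {n : ℕ} : Measurable (uniformDev μ g (n := n)) :=
  measurable_iSup_of_continuous (fun h => by have := hc h; fun_prop) fun h z =>
    (abs_le.1 (abs_deviation_le μ (hg h) hB z)).2

/-- Symmetrization. -/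
theorem integral_uniformDev_le (hc : ∀ h, Continuous (g h)) (hg : ∀ h p, |g h p| ≤ B) (hB : 0 ≤ B)
    {n : ℕ} (hn : 0 < n) :
    ∫ z, uniformDev μ g z ∂(Measure.pi fun _ : Fin n => μ) ≤ 2 * radComplexity μ g n := by
  rcases isEmpty_or_nonempty ι with hι | hι
  · simp [uniformDev, radComplexity, signedSup]
  set P := Measure.pi fun _ : Fin n => μ with hP
  -- `p.1` is the sample and `p.2` an independent ghost sample, whose mean replaces the true
  -- expectation.
  set D : (Fin n → Bool) → (Fin n → Z) × (Fin n → Z) → ℝ := fun σ p =>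
    ⨆ h, (1 / (n : ℝ)) * ∑ i, (if σ i then (1 : ℝ) else -1) * (g h (p.2 i) - g h (p.1 i)) with hD
  have hDeq : ∀ (σ : Fin n → Bool) h (p : (Fin n → Z) × (Fin n → Z)),
      (1 / (n : ℝ)) * ∑ i, (if σ i then (1 : ℝ) else -1) * (g h (p.2 i) - g h (p.1 i)) =
      (1 / (n : ℝ)) * ∑ i, (if σ i then (1 : ℝ) else -1) * g h (p.2 i) +
      (1 / (n : ℝ)) * ∑ i, (if !σ i then (1 : ℝ) else -1) * g h (p.1 i) := by
    intro σ h p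
    rw [← mul_add, ← Finset.sum_add_distrib]
    congr 2 with i
    cases σ i <;> simp <;> ring
  have hDb : ∀ (σ : Fin n → Bool) h (p : (Fin n → Z) × (Fin n → Z)),
      |(1 / (n : ℝ)) * ∑ i, (if σ i then (1 : ℝ) else -1) * (g h (p.2 i) - g h (p.1 i))| ≤
        2 * B := by
    intro σ h p
    rw [hDeq]
    have h1 := abs_signed_average_le (hg h) hB σ p.2
    have h2 := abs_signed_average_le (hg h) hB (fun i => !σ i) p.1
    refine (abs_add_le _ _).trans ?_
    linarith
  have hDm : ∀ σ, Measurable (D σ) := fun σ =>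
    measurable_iSup_of_continuous (fun h => by have := hc h; fun_prop) fun h z =>
      (abs_le.1 (hDb σ h z)).2
  have hDint : ∀ σ, Integrable (D σ) (P.prod P) := fun σ =>
    Integrable.of_bound (hDm σ).aestronglyMeasurable (2 * B)
      (ae_of_all _ fun p => abs_iSup_le (by positivity) fun h => hDb σ h p)
  have hle : ∫ z, uniformDev μ g z ∂P ≤ ∫ p, D (fun _ => true) p ∂(P.prod P) := by
    rw [integral_prod _ (hDint _)]
    refine integral_mono (Integrable.of_bound (measurable_uniformDev μ hc hg hB).aestronglyMeasurable
      (2 * B) (ae_of_all _ (abs_uniformDev_le μ hg hB))) (hDint _).integral_prod_left fun z => ?_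
    refine ciSup_le fun h => ?_
    have hgi : ∀ i : Fin n, Integrable (fun z' : Fin n → Z => g h (z' i)) P := fun i =>
      Integrable.of_bound ((hc h).comp (continuous_apply i)).measurable.aestronglyMeasurable B
        (ae_of_all _ fun z' => hg h _)
    have hmean : ∀ i : Fin n, ∫ z', g h (z' i) ∂P = ∫ p, g h p ∂μ := fun i => by
      have := measurePreserving_eval (fun _ : Fin n => μ) i
      conv_rhs => rw [← this.map_eq]
      rw [integral_map this.measurable.aemeasurable (hc h).measurable.aestronglyMeasurable]
    calc (∫ p, g h p ∂μ) - (1 / (n : ℝ)) * ∑ i, g h (z i)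
        = ∫ z', (1 / (n : ℝ)) * ∑ i, (g h (z' i) - g h (z i)) ∂P := by
          have hsum : ∫ z', ∑ i, (g h (z' i) - g h (z i)) ∂P =
              ∑ i, ∫ z', (g h (z' i) - g h (z i)) ∂P :=
            integral_finsetSum _ fun i _ => (hgi i).sub (integrable_const _)
          rw [integral_const_mul, hsum]
          simp_rw [integral_sub (hgi _) (integrable_const _), hmean]
          simp
          field_simp
      _ ≤ ∫ z', D (fun _ => true) (z, z') ∂P := by
          refine integral_mono ((integrable_finsetSum _ fun i _ =>
            (hgi i).sub (integrable_const _)).const_mul _) ?_ fun z' => ?_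
          · exact Integrable.of_bound ((hDm _).comp
              (measurable_const.prodMk measurable_id)).aestronglyMeasurable (2 * B)
              (ae_of_all _ fun z' => abs_iSup_le (by positivity) fun h => hDb _ h _)
          · have := le_ciSup (f := fun h => (1 / (n : ℝ)) * ∑ i, (if true then (1 : ℝ) else -1) *
              (g h (z' i) - g h (z i)))
              ⟨2 * B, by rintro _ ⟨j, rfl⟩; exact (abs_le.1 (hDb (fun _ => true) j (z, z'))).2⟩ h
            simpa [hD] using this
  have hswap : ∀ σ, ∫ p, D (fun _ => true) p ∂(P.prod P) = ∫ p, D σ p ∂(P.prod P) := by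
    intro σ
    have hs := measurePreserving_swap_coordinates μ σ
    conv_lhs => rw [hP, ← hs.map_eq]
    rw [integral_map hs.measurable.aemeasurable (hDm _).aestronglyMeasurable]
    congr 1 with p
    simp only [hD]
    congr 1 with h
    congr 2 with i
    cases σ i <;> simp
  have hsplit : ∀ σ, ∫ p, D σ p ∂(P.prod P) ≤
      (∫ z, signedSup g σ z ∂P) + ∫ z, signedSup g (fun i => !σ i) z ∂P := by
    intro σ
    have i1 : Integrable (fun p : (Fin n → Z) × (Fin n → Z) => signedSup g σ p.2) (P.prod P) :=
      (integrable_signedSup μ hc hg hB σ).comp_snd P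
    have i2 : Integrable (fun p : (Fin n → Z) × (Fin n → Z) => signedSup g (fun i => !σ i) p.1)
        (P.prod P) := (integrable_signedSup μ hc hg hB _).comp_fst P
    calc _ ≤ ∫ p, (signedSup g σ p.2 + signedSup g (fun i => !σ i) p.1) ∂(P.prod P) := by
          refine integral_mono (hDint σ) (i1.add i2) fun p => ciSup_le fun h => ?_
          rw [hDeq]
          exact add_le_add (le_signedSup hg hB _ _ h) (le_signedSup hg hB (fun i => !σ i) _ h)
      _ = _ := by
          rw [integral_add i1 i2, integral_fun_snd, integral_fun_fst]
          simp
  rw [radComplexity_eq μ hc hg hB]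
  refine hle.trans ?_
  have hcard : ∑ _σ : Fin n → Bool, (∫ p, D (fun _ => true) p ∂(P.prod P)) =
      2 ^ n * ∫ p, D (fun _ => true) p ∂(P.prod P) := by simp
  -- Flipping all signs permutes the sign vectors, so both halves of `hsplit` have the same average;
  -- hence the factor 2.
  have hflip : ∑ σ : Fin n → Bool, ∫ z, signedSup g (fun i => !σ i) z ∂P =
      ∑ σ : Fin n → Bool, ∫ z, signedSup g σ z ∂P :=
    (Equiv.piCongrRight fun _ : Fin n => Equiv.boolNot).sum_comp
      fun σ => ∫ z, signedSup g σ z ∂P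
  have := Finset.sum_le_sum fun σ (_ : σ ∈ Finset.univ) => (hswap σ).le.trans (hsplit σ)
  rw [hcard, Finset.sum_add_distrib, hflip] at this
  have hpos : (0 : ℝ) < 2 ^ n := by positivity
  calc _ = (1 / 2 ^ n : ℝ) * (2 ^ n * ∫ p, D (fun _ => true) p ∂(P.prod P)) := by field_simp
    _ ≤ (1 / 2 ^ n : ℝ) * ((∑ σ : Fin n → Bool, ∫ z, signedSup g σ z ∂P) +
        ∑ σ : Fin n → Bool, ∫ z, signedSup g σ z ∂P) := by gcongr
    _ = _ := by ring

/-- The uniform deviation of functions with values in `[0, B]` is sub-Gaussian. -/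
theorem hasSubgaussianMGF_uniformDev {B : ℝ≥0} (hc : ∀ h, Continuous (g h))
    (hg : ∀ h p, 0 ≤ g h p ∧ g h p ≤ B) (n : ℕ) :
    HasSubgaussianMGF
      (fun z => uniformDev μ g z - ∫ z, uniformDev μ g z ∂(Measure.pi fun _ : Fin n => μ))
      (n * (B / n / 2) ^ 2) (Measure.pi fun _ : Fin n => μ) := by
  have hg' : ∀ h p, |g h p| ≤ B := fun h p => by
    rw [abs_of_nonneg (hg h p).1]
    exact (hg h p).2
  have := hasSubgaussianMGF_pi_of_bounded_differences (fun _ : Fin n => μ)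
    (measurable_uniformDev μ hc hg' B.2) (abs_uniformDev_le μ hg' B.2) (fun _ => B / n)
    fun i z x => by
      rcases isEmpty_or_nonempty ι with hι | hι
      · simpa [uniformDev] using div_nonneg B.2 n.cast_nonneg
      rw [sub_le_iff_le_add]
      refine ciSup_le fun h => ?_
      have h1 := le_uniformDev μ hg' B.2 z h
      -- The values lie in `[0, B]`, so changing one point costs `B`, not `2 * B`.
      have h2 : ∑ j, g h (z j) ≤ (∑ j, g h (Function.update z i x j)) + B := by
        rw [← Finset.add_sum_erase _ _ (Finset.mem_univ i),
          ← Finset.add_sum_erase _ (fun j => g h (Function.update z i x j)) (Finset.mem_univ i)]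
        have h3 : ∑ j ∈ Finset.univ.erase i, g h (Function.update z i x j) =
            ∑ j ∈ Finset.univ.erase i, g h (z j) :=
          Finset.sum_congr rfl fun j hj => by
            rw [Function.update_of_ne (Finset.ne_of_mem_erase hj)]
        rw [h3]
        have := (hg h (z i)).2
        have := (hg h (Function.update z i x i)).1
        linarith
      have h4 : (1 / (n : ℝ)) * ∑ j, g h (z j) ≤
          (1 / (n : ℝ)) * ∑ j, g h (Function.update z i x j) + B / n := by
        calc _ ≤ (1 / (n : ℝ)) * ((∑ j, g h (Function.update z i x j)) + B) := by gcongr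
          _ = _ := by ring
      push_cast
      linarith
  simpa using this

end Rademacher

/-! ### Mean absolute deviation of averages. -/

section Averages

variable {Z : Type*} [MeasurableSpace Z]

/-- The variance of the sum over `I` is at most `|I|`. The coordinates outside `I` may have any law,
as needed after conditioning on the labels. -/
lemma integral_abs_sum_div_sub_le {n : ℕ} (ν : Fin n → Measure Z)
    [∀ i, IsProbabilityMeasure (ν i)] {I : Finset (Fin n)} (hI : I.Nonempty) {f : Z → ℝ}
    (hf : Measurable f) (hf01 : ∀ z, f z ∈ Set.Icc (0 : ℝ) 1) {p : ℝ}
    (hp : ∀ i ∈ I, ∫ z, f z ∂(ν i) = p) :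
    ∫ z, |(1 / (I.card : ℝ)) * (∑ i ∈ I, f (z i)) - p| ∂(Measure.pi ν) ≤ 1 / √I.card := by
  set k : ℝ := (I.card : ℝ) with hk
  have hk0 : 0 < k := by
    rw [hk]
    exact_mod_cast hI.card_pos
  set X : Fin n → Z → ℝ := fun i z => if i ∈ I then f z - p else 0 with hX
  have hfi : ∀ i, Integrable f (ν i) := fun i =>
    Integrable.of_mem_Icc 0 1 hf.aemeasurable (ae_of_all _ hf01)
  have hXm : ∀ i, Measurable (X i) := fun i => by
    simp only [hX]
    split_ifs <;> fun_prop
  have hXb : ∀ i z, |X i z| ≤ 1 + |p| := fun i z => by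
    simp only [hX]
    split_ifs
    · have := hf01 z
      calc |f z - p| ≤ |f z| + |p| := abs_sub _ _
        _ ≤ 1 + |p| := by
          gcongr
          rw [abs_of_nonneg this.1]
          exact this.2
    · simp only [abs_zero]
      positivity
  have hXL : ∀ i, MemLp (X i) 2 (ν i) := fun i =>
    MemLp.of_bound (hXm i).aestronglyMeasurable (1 + |p|) (ae_of_all _ (hXb i))
  have hXmean : ∀ i, ∫ z, X i z ∂(ν i) = 0 := fun i => by
    by_cases hi : i ∈ I
    · simp [hX, hi, integral_sub (hfi i) (integrable_const _), hp i hi]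
    · simp [hX, hi]
  have hvar : ∀ i, Var[X i; ν i] ≤ if i ∈ I then 1 else 0 := fun i => by
    by_cases hi : i ∈ I
    · have h := variance_le_sq_of_bounded (μ := ν i) (X := X i) (a := -p) (b := 1 - p)
        (ae_of_all _ fun z => by
          have := hf01 z
          simp only [hX, hi, if_true]
          constructor <;> linarith [this.1, this.2]) (hXm i).aemeasurable
      refine h.trans ?_
      simp only [hi, if_true]
      norm_num
    · have : X i = 0 := by
        funext z
        simp [hX, hi]
      simp [this, hi]
  have hS : ∀ z : Fin n → Z, (∑ i, fun z : Fin n → Z => X i (z i)) z =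
      k * ((1 / k) * (∑ i ∈ I, f (z i)) - p) := fun z => by
    rw [Finset.sum_apply]
    simp only [hX]
    rw [Finset.sum_ite_mem, Finset.univ_inter, Finset.sum_sub_distrib]
    simp only [Finset.sum_const, nsmul_eq_mul, ← hk]
    field_simp
  have hXi : ∀ i, Integrable (fun z : Fin n → Z => X i (z i)) (Measure.pi ν) := fun i =>
    Integrable.of_bound ((hXm i).comp (measurable_pi_apply i)).aestronglyMeasurable (1 + |p|)
      (ae_of_all _ fun z => hXb i _)
  have hsum : Measurable (∑ i, fun z : Fin n → Z => X i (z i)) := by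
    rw [show (∑ i, fun z : Fin n → Z => X i (z i)) = fun z => ∑ i, X i (z i) from
      funext fun z => Finset.sum_apply _ _ _]
    exact Finset.measurable_sum _ fun i _ => (hXm i).comp (measurable_pi_apply i)
  have hmean : ∫ z, (∑ i, fun z : Fin n → Z => X i (z i)) z ∂(Measure.pi ν) = 0 := by
    simp_rw [Finset.sum_apply]
    rw [integral_finsetSum _ fun i _ => hXi i]
    refine Finset.sum_eq_zero fun i _ => ?_
    rw [← hXmean i]
    have h := measurePreserving_eval ν i
    conv_rhs => rw [← h.map_eq]
    rw [integral_map h.measurable.aemeasurable (hXm i).aestronglyMeasurable]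
  have hsq : ∫ z, (k * ((1 / k) * (∑ i ∈ I, f (z i)) - p)) ^ 2 ∂(Measure.pi ν) ≤ k := by
    have h1 := variance_sum_pi (μ := ν) hXL
    rw [variance_of_integral_eq_zero hsum.aemeasurable hmean] at h1
    simp_rw [hS] at h1
    rw [h1]
    refine (Finset.sum_le_sum fun i _ => hvar i).trans ?_
    simp [hk]
  have hgb : ∀ z : Fin n → Z, |(1 / k) * (∑ i ∈ I, f (z i)) - p| ≤ 1 + |p| := fun z => by
    refine (abs_sub _ _).trans ?_
    gcongr
    rw [abs_of_nonneg (mul_nonneg (by positivity) (Finset.sum_nonneg fun i _ => (hf01 _).1))]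
    calc (1 / k) * (∑ i ∈ I, f (z i)) ≤ (1 / k) * (∑ i ∈ I, 1) := by
          gcongr with i
          exact (hf01 _).2
      _ = 1 := by
          simp only [Finset.sum_const, nsmul_eq_mul, ← hk]
          field_simp
  have hgm : Measurable fun z : Fin n → Z => (1 / k) * (∑ i ∈ I, f (z i)) - p := by fun_prop
  have hgi : Integrable (fun z : Fin n → Z => |(1 / k) * (∑ i ∈ I, f (z i)) - p|) (Measure.pi ν) :=
    (Integrable.of_bound hgm.aestronglyMeasurable (1 + |p|) (ae_of_all _ hgb)).abs
  have hsqi : Integrable (fun z : Fin n → Z => (k * ((1 / k) * (∑ i ∈ I, f (z i)) - p)) ^ 2)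
      (Measure.pi ν) :=
    Integrable.of_bound ((hgm.const_mul k).pow_const 2).aestronglyMeasurable ((k * (1 + |p|)) ^ 2)
      (ae_of_all _ fun z => by
        rw [Real.norm_eq_abs, abs_pow, abs_mul, abs_of_pos hk0]
        gcongr
        exact hgb z)
  have hsk : 0 < √k := Real.sqrt_pos.2 hk0
  have hskk : √k ^ 2 = k := Real.sq_sqrt hk0.le
  -- With `g` the deviation, this is `|g| ≤ 1/(2√k) + √k g²/2`, a completed square that takes the
  -- place of Cauchy–Schwarz.
  have hpt : ∀ z : Fin n → Z, |(1 / k) * (∑ i ∈ I, f (z i)) - p| ≤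
      (1 / 2) * (1 / √k) + (1 / (2 * k * √k)) *
        (k * ((1 / k) * (∑ i ∈ I, f (z i)) - p)) ^ 2 := fun z => by
    set g := (1 / k) * (∑ i ∈ I, f (z i)) - p
    have h1 : (1 / 2) * (1 / √k) + (1 / (2 * k * √k)) * (k * g) ^ 2 - |g| =
        (1 / (2 * √k)) * (1 - √k * |g|) ^ 2 := by
      have : (k * g) ^ 2 = k ^ 2 * |g| ^ 2 := by rw [sq_abs]; ring
      rw [this, sub_sq, mul_pow, hskk]
      field_simp
      ring
    have h2 : 0 ≤ (1 / (2 * √k)) * (1 - √k * |g|) ^ 2 := by positivity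
    linarith
  calc _ ≤ ∫ z, ((1 / 2) * (1 / √k) + (1 / (2 * k * √k)) *
        (k * ((1 / k) * (∑ i ∈ I, f (z i)) - p)) ^ 2) ∂(Measure.pi ν) :=
        integral_mono hgi ((integrable_const _).add (hsqi.const_mul _)) hpt
    _ ≤ (1 / 2) * (1 / √k) + (1 / (2 * k * √k)) * k := by
        rw [integral_add (integrable_const _) (hsqi.const_mul _),
          integral_const_mul (1 / (2 * k * √k))]
        simp only [integral_const, probReal_univ, one_smul]
        gcongr
    _ = 1 / √k := by
        field_simp
        norm_num

end Averages

/-! ### Uniform deviation over 1-Lipschitz functions. -/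

section LipschitzDeviation

variable {X : Type*} [MetricSpace X] [SecondCountableTopology X] [MeasurableSpace X] [BorelSpace X]

/-- The one-sided deviation of the averages of `1`-Lipschitz functions over the sample points
with index in `I` from the integrals with respect to `μ`. -/
def lipDev (μ : Measure X) {n : ℕ} (I : Finset (Fin n)) (x : Fin n → X) : ℝ :=
  ⨆ f : {f : X → ℝ // LipschitzWith 1 f},
    ((1 / (I.card : ℝ)) * (∑ i ∈ I, f.1 (x i)) - ∫ x, f.1 x ∂μ)

variable (μ : Measure X) [IsProbabilityMeasure μ] {D : ℝ} (hD : ∀ x y : X, dist x y ≤ D)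

include hD

lemma integrable_of_lipschitz {K : ℝ≥0} {f : X → ℝ} (hf : LipschitzWith K f) : Integrable f μ := by
  have hne : Nonempty X := by
    by_contra hA
    rw [not_nonempty_iff] at hA
    exact IsProbabilityMeasure.ne_zero μ (Measure.eq_zero_of_isEmpty μ)
  have x0 := hne.some
  refine Integrable.of_bound hf.continuous.measurable.aestronglyMeasurable (|f x0| + K * D)
    (ae_of_all _ fun x => ?_)
  have h1 := hf.dist_le_mul x x0
  rw [Real.dist_eq] at h1
  have h2 : K * dist x x0 ≤ K * D := by
    gcongr
    exact hD x x0
  have h3 := abs_sub_abs_le_abs_sub (f x) (f x0)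
  rw [Real.norm_eq_abs]
  linarith

lemma abs_lipschitz_average_sub_le {f : X → ℝ} (hf : LipschitzWith 1 f) {n : ℕ}
    {I : Finset (Fin n)} (hI : I.Nonempty) (x : Fin n → X) :
    |(1 / (I.card : ℝ)) * (∑ i ∈ I, f (x i)) - ∫ x, f x ∂μ| ≤ D := by
  have hk0 : (0 : ℝ) < I.card := by exact_mod_cast hI.card_pos
  have hpt : ∀ y, |f y - ∫ x, f x ∂μ| ≤ D := fun y => by
    have h : f y - ∫ x, f x ∂μ = ∫ x, (f y - f x) ∂μ := by
      rw [integral_sub (integrable_const _) (integrable_of_lipschitz μ hD hf)]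
      simp
    rw [h]
    refine abs_integral_le_of_abs_le μ fun x => ?_
    have h1 := hf.dist_le_mul y x
    rw [Real.dist_eq, NNReal.coe_one, one_mul] at h1
    exact h1.trans (hD y x)
  have h : (1 / (I.card : ℝ)) * (∑ i ∈ I, f (x i)) - ∫ x, f x ∂μ =
      (1 / (I.card : ℝ)) * ∑ i ∈ I, (f (x i) - ∫ x, f x ∂μ) := by
    rw [Finset.sum_sub_distrib]
    simp only [Finset.sum_const, nsmul_eq_mul]
    field_simp
  rw [h, abs_mul, abs_of_pos (by positivity : (0 : ℝ) < 1 / I.card)]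
  calc _ ≤ (1 / (I.card : ℝ)) * ∑ i ∈ I, D := by
        gcongr
        exact (Finset.abs_sum_le_sum_abs _ _).trans (Finset.sum_le_sum fun i _ => hpt _)
    _ = D := by
        simp only [Finset.sum_const, nsmul_eq_mul]
        field_simp

lemma le_lipDev {f : X → ℝ} (hf : LipschitzWith 1 f) {n : ℕ} {I : Finset (Fin n)}
    (hI : I.Nonempty) (x : Fin n → X) :
    (1 / (I.card : ℝ)) * (∑ i ∈ I, f (x i)) - ∫ x, f x ∂μ ≤ lipDev μ I x :=
  le_ciSup (f := fun f : {f : X → ℝ // LipschitzWith 1 f} =>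
      (1 / (I.card : ℝ)) * (∑ i ∈ I, f.1 (x i)) - ∫ x, f.1 x ∂μ)
    ⟨D, by
      rintro _ ⟨g, rfl⟩
      exact (abs_le.1 (abs_lipschitz_average_sub_le μ hD g.2 hI x)).2⟩ ⟨f, hf⟩

lemma abs_lipDev_le (hD0 : 0 ≤ D) {n : ℕ} {I : Finset (Fin n)} (hI : I.Nonempty) (x : Fin n → X) :
    |lipDev μ I x| ≤ D :=
  abs_iSup_le hD0 fun f => abs_lipschitz_average_sub_le μ hD f.2 hI x

lemma measurable_lipDev {n : ℕ} {I : Finset (Fin n)} (hI : I.Nonempty) :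
    Measurable (lipDev μ I) :=
  measurable_iSup_of_continuous
    (fun f => by have := f.2.continuous; fun_prop) fun f x =>
    (abs_le.1 (abs_lipschitz_average_sub_le μ hD f.2 hI x)).2

lemma lipDev_update_sub_le {n : ℕ} {I : Finset (Fin n)} (hI : I.Nonempty)
    (i : Fin n) (x : Fin n → X) (y : X) :
    lipDev μ I (Function.update x i y) - lipDev μ I x ≤ if i ∈ I then D / I.card else 0 := by
  have : Nonempty {f : X → ℝ // LipschitzWith 1 f} := ⟨⟨fun _ => 0, LipschitzWith.const' 0⟩⟩
  rw [sub_le_iff_le_add]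
  refine ciSup_le fun f => ?_
  have h1 := le_lipDev μ hD f.2 hI x
  have h2 : ∑ j ∈ I, f.1 (Function.update x i y j) ≤
      (∑ j ∈ I, f.1 (x j)) + if i ∈ I then D else 0 := by
    split_ifs with hi
    · rw [← Finset.add_sum_erase _ _ hi, ← Finset.add_sum_erase _ (fun j => f.1 (x j)) hi]
      have h3 : ∑ j ∈ I.erase i, f.1 (Function.update x i y j) = ∑ j ∈ I.erase i, f.1 (x j) :=
        Finset.sum_congr rfl fun j hj => by
          rw [Function.update_of_ne (Finset.ne_of_mem_erase hj)]
      rw [h3, Function.update_self]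
      have h4 := f.2.dist_le_mul y (x i)
      rw [Real.dist_eq, NNReal.coe_one, one_mul] at h4
      have := hD y (x i)
      have := le_abs_self (f.1 y - f.1 (x i))
      linarith
    · rw [add_zero]
      refine (Finset.sum_congr rfl fun j hj => ?_).le
      rw [Function.update_of_ne]
      rintro rfl
      exact hi hj
  have h5 : (1 / (I.card : ℝ)) * ∑ j ∈ I, f.1 (Function.update x i y j) ≤
      (1 / (I.card : ℝ)) * ∑ j ∈ I, f.1 (x j) + if i ∈ I then D / I.card else 0 := by
    calc _ ≤ (1 / (I.card : ℝ)) * ((∑ j ∈ I, f.1 (x j)) + if i ∈ I then D else 0) := by gcongr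
      _ = _ := by split_ifs <;> ring
  linarith

/-- Concentration of the deviation of the averages of `1`-Lipschitz functions. -/
lemma measure_lipDev_gt_le (hD0 : 0 ≤ D) {n : ℕ} (ν : Fin n → Measure X)
    [∀ i, IsProbabilityMeasure (ν i)] {I : Finset (Fin n)} (hI : I.Nonempty) {m : ℝ}
    (hm : ∫ x, lipDev μ I x ∂(Measure.pi ν) ≤ m) {δ : ℝ} (hδ : 0 < δ) (hδ1 : δ ≤ 1) :
    Measure.pi ν {x | m + D * √((1 / 2) * Real.log (1 / δ)) * √(1 / (I.card : ℝ)) < lipDev μ I x} ≤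
      ENNReal.ofReal δ := by
  have hk0 : (0 : ℝ) < I.card := by exact_mod_cast hI.card_pos
  have h := hasSubgaussianMGF_pi_of_bounded_differences ν (measurable_lipDev μ hD hI)
    (abs_lipDev_le μ hD hD0 hI) (fun i => if i ∈ I then D.toNNReal / I.card else 0)
    fun i x y => (lipDev_update_sub_le μ hD hI i x y).trans (by
      split_ifs <;> simp [hD0])
  refine (measure_mono ?_).trans (HasSubgaussianMGF.measure_gt_le h hδ hδ1)
  intro x hx
  rw [Set.mem_ofPred_eq] at hx ⊢
  have hlog : 0 ≤ Real.log (1 / δ) := Real.log_nonneg (by rw [le_div_iff₀ hδ]; linarith)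
  have hc : ((∑ i, ((if i ∈ I then D.toNNReal / I.card else 0) / 2) ^ 2 : ℝ≥0) : ℝ) =
      D ^ 2 / (4 * I.card) := by
    push_cast
    have : ∀ i, (((if i ∈ I then D.toNNReal / I.card else 0 : ℝ≥0) : ℝ) / 2) ^ 2 =
        if i ∈ I then (D / I.card / 2) ^ 2 else 0 := fun i => by
      split_ifs <;> simp [hD0]
    simp_rw [this]
    simp
    field_simp
    norm_num
  rw [hc]
  have hs : √(2 * (D ^ 2 / (4 * I.card)) * Real.log (1 / δ)) =
      D * √((1 / 2) * Real.log (1 / δ)) * √(1 / (I.card : ℝ)) := by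
    rw [show 2 * (D ^ 2 / (4 * I.card)) * Real.log (1 / δ) =
      D ^ 2 * ((1 / 2) * Real.log (1 / δ)) * (1 / (I.card : ℝ)) by field_simp; ring,
      Real.sqrt_mul (by positivity), Real.sqrt_mul (by positivity), Real.sqrt_sq hD0]
  rw [hs]
  linarith

/-- A 1-Lipschitz function is within `ε` of a function constant on the cells, once for the average
and once for the integral. For the step function only the cell frequencies matter, uniformly in `f`.
-/
lemma lipDev_le_of_partition {ι : Type*} {π : X → ι} {s : Finset ι}
    (hs : ∀ x, π x ∈ s) (hπ : ∀ c, MeasurableSet (π ⁻¹' {c})) {ε : ℝ}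
    (hε : ∀ x y, π x = π y → dist x y ≤ ε) {n : ℕ} {I : Finset (Fin n)} (hI : I.Nonempty)
    (x : Fin n → X) :
    lipDev μ I x ≤ 2 * ε + D * ∑ c ∈ s, |(1 / (I.card : ℝ)) *
      (∑ i ∈ I, (π ⁻¹' {c}).indicator 1 (x i)) - μ.real (π ⁻¹' {c})| := by
  have hk0 : (0 : ℝ) < I.card := by exact_mod_cast hI.card_pos
  classical
  obtain ⟨i0, -⟩ := hI
  set x0 := x i0
  have : Nonempty {f : X → ℝ // LipschitzWith 1 f} := ⟨⟨fun _ => 0, LipschitzWith.const' 0⟩⟩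
  refine ciSup_le fun ⟨f, hf⟩ => ?_
  have hfd : ∀ a b, |f a - f b| ≤ dist a b := fun a b => by
    simpa [Real.dist_eq] using hf.dist_le_mul a b
  -- A representative of each cell; the value at an empty cell is irrelevant.
  set r : ι → X := fun c => if h : ∃ y, π y = c then h.choose else x0 with hr
  have hrπ : ∀ y, π (r (π y)) = π y := fun y => by
    have h : ∃ y', π y' = π y := ⟨y, rfl⟩
    simp only [hr, h, dif_pos]
    exact h.choose_spec
  -- Subtracting `f x0` makes the coefficients at most `D` in absolute value, although `f` itself
  -- has no common bound.
  set g : ι → ℝ := fun c => f (r c) - f x0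
  have hg : ∀ c, |g c| ≤ D := fun c => (hfd _ _).trans (hD _ _)
  set G : X → ℝ := fun y => ∑ c ∈ s, g c * (π ⁻¹' {c}).indicator 1 y with hG
  have hGπ : ∀ y, G y = g (π y) := fun y => by
    simp only [hG, Set.indicator_apply, Set.mem_preimage, Set.mem_singleton_iff, Pi.one_apply]
    rw [Finset.sum_eq_single_of_mem (π y) (hs y)]
    · simp
    · intro c _ hc
      simp [Ne.symm hc]
  have hfG : ∀ y, |f y - (f x0 + G y)| ≤ ε := fun y => by
    rw [hGπ, show f y - (f x0 + g (π y)) = f y - f (r (π y)) by simp only [g]; ring]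
    exact (hfd _ _).trans (hε _ _ (hrπ y).symm)
  have hind : ∀ c, Integrable ((π ⁻¹' {c}).indicator (1 : X → ℝ)) μ := fun c =>
    (integrable_const (1 : ℝ)).indicator (hπ c)
  have hGi : Integrable G μ := integrable_finsetSum _ fun c _ => (hind c).const_mul _
  have hGint : ∫ y, G y ∂μ = ∑ c ∈ s, g c * μ.real (π ⁻¹' {c}) := by
    simp only [hG]
    rw [integral_finsetSum _ fun c _ => (hind c).const_mul _]
    refine Finset.sum_congr rfl fun c _ => ?_
    rw [integral_const_mul, integral_indicator_one (hπ c)]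
  have hlow : f x0 + (∑ c ∈ s, g c * μ.real (π ⁻¹' {c})) - ε ≤ ∫ y, f y ∂μ := by
    have : ∫ y, (f x0 + G y - ε) ∂μ ≤ ∫ y, f y ∂μ :=
      integral_mono (((integrable_const _).add hGi).sub (integrable_const _))
        (integrable_of_lipschitz μ hD hf) fun y => by
          have := (abs_le.1 (hfG y)).1
          simp only [] at *
          linarith
    have h2 : ∫ y, (f x0 + G y - ε) ∂μ = ∫ y, (f x0 + G y) ∂μ - ∫ _, ε ∂μ :=
      integral_sub ((integrable_const _).add hGi) (integrable_const _)
    rw [h2, integral_add (integrable_const _) hGi, hGint] at this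
    simpa using this
  have hup : (1 / (I.card : ℝ)) * ∑ i ∈ I, f (x i) ≤ f x0 + ε +
      ∑ c ∈ s, g c * ((1 / (I.card : ℝ)) * ∑ i ∈ I, (π ⁻¹' {c}).indicator 1 (x i)) := by
    calc (1 / (I.card : ℝ)) * ∑ i ∈ I, f (x i)
        ≤ (1 / (I.card : ℝ)) * ∑ i ∈ I, (f x0 + ε + G (x i)) := by
          gcongr with i
          have := (abs_le.1 (hfG (x i))).2
          linarith
      _ = _ := by
          rw [Finset.sum_add_distrib, mul_add, hG]
          simp only [Finset.sum_const, nsmul_eq_mul]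
          rw [Finset.sum_comm]
          congr 1
          · field_simp
          · rw [Finset.mul_sum]
            refine Finset.sum_congr rfl fun c _ => ?_
            rw [← Finset.mul_sum]
            ring
  have hdiff : ∑ c ∈ s, g c * ((1 / (I.card : ℝ)) * ∑ i ∈ I, (π ⁻¹' {c}).indicator 1 (x i)) -
      ∑ c ∈ s, g c * μ.real (π ⁻¹' {c}) ≤ D * ∑ c ∈ s, |(1 / (I.card : ℝ)) *
      (∑ i ∈ I, (π ⁻¹' {c}).indicator 1 (x i)) - μ.real (π ⁻¹' {c})| := by
    rw [← Finset.sum_sub_distrib, Finset.mul_sum]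
    refine Finset.sum_le_sum fun c _ => ?_
    rw [← mul_sub]
    refine (le_abs_self _).trans ?_
    rw [abs_mul]
    gcongr
    exact hg c
  simp only [] at *
  linarith

lemma integral_lipDev_le_of_partition (hD0 : 0 ≤ D) {ι : Type*} {π : X → ι}
    {s : Finset ι} (hs : ∀ x, π x ∈ s) (hπ : ∀ c, MeasurableSet (π ⁻¹' {c})) {ε : ℝ}
    (hε : ∀ x y, π x = π y → dist x y ≤ ε) {n : ℕ} (ν : Fin n → Measure X)
    [∀ i, IsProbabilityMeasure (ν i)] {I : Finset (Fin n)} (hI : I.Nonempty)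
    (hν : ∀ i ∈ I, ν i = μ) :
    ∫ x, lipDev μ I x ∂(Measure.pi ν) ≤ 2 * ε + D * (s.card * (1 / √I.card)) := by
  have hm : ∀ c, Measurable ((π ⁻¹' {c}).indicator (1 : X → ℝ)) := fun c =>
    measurable_one.indicator (hπ c)
  have h01 : ∀ c y, (π ⁻¹' {c}).indicator (1 : X → ℝ) y ∈ Set.Icc (0 : ℝ) 1 := fun c y => by
    by_cases hy : y ∈ π ⁻¹' {c} <;> simp [hy]
  have hi : ∀ c, Integrable (fun x : Fin n → X => |(1 / (I.card : ℝ)) *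
      (∑ i ∈ I, (π ⁻¹' {c}).indicator 1 (x i)) - μ.real (π ⁻¹' {c})|) (Measure.pi ν) := fun c => by
    refine Integrable.abs (Integrable.sub (Integrable.const_mul (integrable_finsetSum _
      fun i _ => ?_) _) (integrable_const _))
    exact Integrable.of_bound ((hm c).comp (measurable_pi_apply i)).aestronglyMeasurable 1
      (ae_of_all _ fun x => by
        rw [Real.norm_eq_abs, abs_of_nonneg (h01 c _).1]
        exact (h01 c _).2)
  calc _ ≤ ∫ x, (2 * ε + D * ∑ c ∈ s, |(1 / (I.card : ℝ)) *
        (∑ i ∈ I, (π ⁻¹' {c}).indicator 1 (x i)) - μ.real (π ⁻¹' {c})|) ∂(Measure.pi ν) :=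
        integral_mono (Integrable.of_bound (measurable_lipDev μ hD hI).aestronglyMeasurable D
          (ae_of_all _ (abs_lipDev_le μ hD hD0 hI)))
          ((integrable_const _).add ((integrable_finsetSum _ fun c _ => hi c).const_mul _))
          (lipDev_le_of_partition μ hD hs hπ hε hI)
    _ ≤ _ := by
        rw [integral_add (integrable_const _) ((integrable_finsetSum _ fun c _ => hi c).const_mul _),
          integral_const_mul D, integral_finsetSum _ fun c _ => hi c]
        simp only [integral_const, probReal_univ, one_smul]
        gcongr
        calc _ ≤ ∑ c ∈ s, 1 / √(I.card : ℝ) := Finset.sum_le_sum fun c _ =>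
              integral_abs_sum_div_sub_le ν hI (hm c) (h01 c) fun i hi => by
                rw [hν i hi, integral_indicator_one (hπ c)]
          _ = _ := by simp

end LipschitzDeviation

/-! ### Grids in Euclidean space and the resulting rate. -/

section Euclidean

variable {d : ℕ} {X : Set (EuclideanSpace ℝ (Fin d))}

lemma exists_grid_partition {R : ℝ} (hX : ∀ x ∈ X, ‖x‖ ≤ R) (hR : 0 ≤ R) {η : ℝ} (hη : 0 < η)
    (hη1 : η ≤ 1) :
    ∃ (π : X → Fin d → ℤ) (s : Finset (Fin d → ℤ)), (∀ x, π x ∈ s) ∧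
      (∀ c, MeasurableSet (π ⁻¹' {c})) ∧ (∀ x y, π x = π y → dist x y ≤ √d * η) ∧
      (s.card : ℝ) ≤ ((2 * R + 2) / η) ^ d := by
  refine ⟨fun x j => ⌊x.1 j / η⌋, Fintype.piFinset fun _ => Finset.Icc ⌊-R / η⌋ ⌊R / η⌋,
    fun x => ?_, fun c => ?_, fun x y hxy => ?_, ?_⟩
  · rw [Fintype.mem_piFinset]
    intro j
    have h1 : |x.1 j| ≤ R := (PiLp.norm_apply_le x.1 j).trans (hX _ x.2)
    rw [abs_le] at h1
    rw [Finset.mem_Icc]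
    exact ⟨Int.floor_le_floor (by gcongr; exact h1.1), Int.floor_le_floor (by gcongr; exact h1.2)⟩
  · have hm : Measurable fun (x : X) (j : Fin d) => ⌊x.1 j / η⌋ := by
      refine measurable_pi_iff.2 fun j => Int.measurable_floor.comp ?_
      have : Continuous fun x : X => x.1 j / η := by fun_prop
      exact this.measurable
    exact hm (measurableSet_singleton c)
  · have h1 : ∀ j, dist (x.1 j) (y.1 j) ≤ η := fun j => by
      have h := Int.abs_sub_lt_one_of_floor_eq_floor (congrFun hxy j)
      rw [← sub_div, abs_div, abs_of_pos hη, div_lt_one hη] at h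
      exact h.le
    rw [Subtype.dist_eq, EuclideanSpace.dist_eq]
    calc √(∑ j, dist (x.1 j) (y.1 j) ^ 2) ≤ √(∑ _j : Fin d, η ^ 2) := by
          gcongr with j
          exact h1 j
      _ = √d * η := by
          simp [Real.sqrt_sq hη.le]
  · rw [Fintype.card_piFinset]
    -- Per coordinate there are at most `2R/η + 2` cells, and `η ≤ 1` bounds this by `(2R + 2)/η`.
    simp only [Finset.prod_const, Finset.card_univ, Fintype.card_fin, Int.card_Icc]
    push_cast
    gcongr
    have h1 : ⌊-R / η⌋ ≤ ⌊R / η⌋ := Int.floor_le_floor (by gcongr; linarith)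
    have h2 : ((⌊R / η⌋ + 1 - ⌊-R / η⌋).toNat : ℝ) = (⌊R / η⌋ : ℝ) + 1 - ⌊-R / η⌋ := by
      have : ((⌊R / η⌋ + 1 - ⌊-R / η⌋).toNat : ℤ) = ⌊R / η⌋ + 1 - ⌊-R / η⌋ :=
        Int.toNat_of_nonneg (by linarith)
      exact_mod_cast congrArg (Int.cast : ℤ → ℝ) this
    rw [h2]
    have h3 := Int.floor_le (R / η)
    have h4 := Int.lt_floor_add_one (-R / η)
    have h5 : (1 : ℝ) ≤ 1 / η := by rwa [le_div_iff₀ hη, one_mul]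
    have h6 : (2 * R + 2) / η = 2 * (R / η) + 2 * (1 / η) := by ring
    have h7 : -R / η = -(R / η) := by ring
    rw [h7] at h4 ⊢
    linarith

/-- The mean deviation of averages of `1`-Lipschitz functions over `k` points of a bounded subset
of `ℝᵈ` is `O(k ^ (-1 / (2 d + 3)))`. -/
lemma integral_lipDev_le {R D : ℝ} (hX : ∀ x ∈ X, ‖x‖ ≤ R) (hR : 0 ≤ R)
    (hD : ∀ x y : X, dist x y ≤ D) (hD0 : 0 ≤ D) (μ : Measure X) [IsProbabilityMeasure μ] {n : ℕ}
    (ν : Fin n → Measure X) [∀ i, IsProbabilityMeasure (ν i)] {I : Finset (Fin n)}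
    (hI : I.Nonempty) (hν : ∀ i ∈ I, ν i = μ) :
    ∫ x, lipDev μ I x ∂(Measure.pi ν) ≤
      (2 * √d + D * (2 * R + 2) ^ d) * (I.card : ℝ) ^ (-(1 / (2 * d + 3 : ℝ))) := by
  set k : ℝ := (I.card : ℝ) with hk
  have hk1 : 1 ≤ k := by
    rw [hk]
    exact_mod_cast hI.card_pos
  have hk0 : 0 < k := by linarith
  set η : ℝ := k ^ (-(1 / (2 * d + 3 : ℝ))) with hη
  have hη0 : 0 < η := Real.rpow_pos_of_pos hk0 _
  have hη1 : η ≤ 1 := Real.rpow_le_one_of_one_le_of_nonpos hk1 (by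
    rw [neg_nonpos]
    positivity)
  obtain ⟨π, s, hs, hπ, hε, hcard⟩ := exists_grid_partition hX hR hη0 hη1
  refine (integral_lipDev_le_of_partition μ hD hD0 hs hπ hε ν hI hν).trans ?_
  -- About `η^(-d)` cells contribute `1/√k` each. The exponent `d/(2d+3) - 1/2 = -3/(2(2d+3))` is
  -- below `-1/(2d+3)`, so the grid error dominates.
  have hrate : (1 / η) ^ d * (1 / √k) ≤ η := by
    have h1 : (1 / η) ^ d * (1 / √k) = k ^ ((d : ℝ) / (2 * d + 3) - 1 / 2) := by
      rw [Real.rpow_sub hk0, Real.sqrt_eq_rpow, hη, Real.rpow_neg hk0.le, one_div, inv_inv,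
        ← Real.rpow_natCast, ← Real.rpow_mul hk0.le]
      rw [show 1 / (2 * (d : ℝ) + 3) * d = d / (2 * d + 3) by ring]
      ring
    rw [h1, hη]
    refine Real.rpow_le_rpow_of_exponent_le hk1 ?_
    rw [div_sub_div _ _ (by positivity) (by norm_num), ← neg_div, div_le_div_iff₀ (by positivity)
      (by positivity)]
    nlinarith
  calc 2 * (√d * η) + D * (s.card * (1 / √k))
      ≤ 2 * (√d * η) + D * (((2 * R + 2) / η) ^ d * (1 / √k)) := by gcongr
    _ = 2 * √d * η + D * (2 * R + 2) ^ d * ((1 / η) ^ d * (1 / √k)) := by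
        rw [div_eq_mul_one_div, mul_pow]
        ring
    _ ≤ 2 * √d * η + D * (2 * R + 2) ^ d * η := by gcongr
    _ = _ := by ring

end Euclidean

/-! ### Empirical class conditionals with random class sizes. -/

section ClassConditional

variable {X Y : Type*} [MeasurableSpace X] [Fintype Y] [DecidableEq Y] [MeasurableSpace Y]
  [MeasurableSingletonClass Y]

/-- The conditional law of `x` given the label `y`. -/
def condLaw (Q : Measure (X × Y)) (y : Y) : Measure X := (Q[|{p | p.2 = y}]).map Prod.fst

/-- The indices of the sample points with label `y`. -/
def classIdx {n : ℕ} (z : Fin n → X × Y) (y : Y) : Finset (Fin n) :=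
  Finset.univ.filter fun i => (z i).2 = y

lemma measurableSet_label (y : Y) : MeasurableSet {p : X × Y | p.2 = y} :=
  measurable_snd (measurableSet_singleton y)

lemma isProbabilityMeasure_condLaw (Q : Measure (X × Y)) [IsProbabilityMeasure Q] {y : Y}
    (hy : Q {p | p.2 = y} ≠ 0) : IsProbabilityMeasure (condLaw Q y) := by
  have := cond_isProbabilityMeasure (μ := Q) hy
  exact Measure.isProbabilityMeasure_map measurable_fst.aemeasurable

lemma sum_measure_label (Q : Measure (X × Y)) [IsProbabilityMeasure Q] :
    ∑ y, Q {p | p.2 = y} = 1 := by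
  have := sum_measure_preimage_singleton (μ := Q) (f := Prod.snd) Finset.univ
    fun y _ => measurable_snd (measurableSet_singleton y)
  simpa [Set.preimage] using this

/-- Given all labels, the sample points remain independent, each with the law conditioned on its own
label. -/
lemma restrict_labels_eq (Q : Measure (X × Y)) [IsProbabilityMeasure Q] {n : ℕ} (v : Fin n → Y)
    (hv : ∀ i, Q {p | p.2 = v i} ≠ 0) :
    (Measure.pi fun _ : Fin n => Q).restrict (Set.univ.pi fun i => {p | p.2 = v i}) =
      (∏ i, Q {p | p.2 = v i}) • Measure.pi fun i => Q[|{p | p.2 = v i}] := by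
  have := fun i => cond_isProbabilityMeasure (μ := Q) (hv i)
  rw [Measure.restrict_pi_pi]
  refine Measure.pi_eq fun t ht => ?_
  rw [Measure.smul_apply, Measure.pi_pi, smul_eq_mul, ← Finset.prod_mul_distrib]
  refine Finset.prod_congr rfl fun i _ => ?_
  rw [ProbabilityTheory.cond, Measure.smul_apply, smul_eq_mul,
    ENNReal.mul_inv_cancel_left (hv i) (measure_ne_top _ _)]

/-- Concentration of the empirical class conditional, with random class size, around the
conditional law. -/
theorem measure_classDev_gt_le {X : Type*} [MetricSpace X] [SecondCountableTopology X]
    [MeasurableSpace X] [BorelSpace X] {D : ℝ} (hD : ∀ x y : X, dist x y ≤ D) (hD0 : 0 ≤ D)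
    (Q : Measure (X × Y)) [IsProbabilityMeasure Q] {y : Y} (hy : Q {p | p.2 = y} ≠ 0) {n : ℕ}
    {m : ℕ → ℝ} (hm : ∀ (I : Finset (Fin n)) (ν : Fin n → Measure X)
      [∀ i, IsProbabilityMeasure (ν i)], I.Nonempty → (∀ i ∈ I, ν i = condLaw Q y) →
      ∫ x, lipDev (condLaw Q y) I x ∂(Measure.pi ν) ≤ m I.card)
    {δ : ℝ} (hδ : 0 < δ) (hδ1 : δ ≤ 1) :
    (Measure.pi fun _ : Fin n => Q) {z | (classIdx z y).Nonempty ∧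
      m (classIdx z y).card + D * √((1 / 2) * Real.log (1 / δ)) *
        √(1 / ((classIdx z y).card : ℝ)) <
      lipDev (condLaw Q y) (classIdx z y) fun i => (z i).1} ≤ ENNReal.ofReal δ := by
  set bad := {z : Fin n → X × Y | (classIdx z y).Nonempty ∧
      m (classIdx z y).card + D * √((1 / 2) * Real.log (1 / δ)) *
        √(1 / ((classIdx z y).card : ℝ)) <
      lipDev (condLaw Q y) (classIdx z y) fun i => (z i).1} with hbad
  have := isProbabilityMeasure_condLaw Q hy
  set P := Measure.pi fun _ : Fin n => Q with hP
  set S : (Fin n → Y) → Set (Fin n → X × Y) := fun v => Set.univ.pi fun i => {p | p.2 = v i} with hS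
  have hSm : ∀ v, MeasurableSet (S v) := fun v =>
    MeasurableSet.univ_pi fun i => measurableSet_label (v i)
  have hPS : ∀ v, P (S v) = ∏ i, Q {p | p.2 = v i} := fun v => Measure.pi_pi _ _
  -- Expanding `(∑ y, Q(y))^n = 1`. Averaging over label vectors costs no union bound.
  have hone : ∑ v, P (S v) = 1 := by
    simp_rw [hPS]
    have h := Finset.prod_univ_sum (fun _ : Fin n => (Finset.univ : Finset Y))
      fun _ y => Q {p : X × Y | p.2 = y}
    rw [Fintype.piFinset_univ] at h
    rw [← h, sum_measure_label]
    simp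
  have hcover : bad ⊆ ⋃ v, bad ∩ S v := fun z hz =>
    Set.mem_iUnion.2 ⟨fun i => (z i).2, hz, fun i _ => rfl⟩
  -- On `S v` the class index set is the fixed set `I`, so the bound for deterministic `I` applies
  -- to the conditional law.
  have hkey : ∀ v, P (bad ∩ S v) ≤ ENNReal.ofReal δ * P (S v) := by
    intro v
    set I : Finset (Fin n) := Finset.univ.filter fun i => v i = y with hI
    have hidx : ∀ z ∈ S v, classIdx z y = I := fun z hz => by
      have : ∀ i, (z i).2 = v i := fun i => hz i (Set.mem_univ i)
      simp [classIdx, hI, this]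
    by_cases hne : I.Nonempty
    · by_cases hv : ∀ i, Q {p | p.2 = v i} ≠ 0
      · have := fun i => cond_isProbabilityMeasure (μ := Q) (hv i)
        set A : Set (Fin n → X) := {x | m I.card + D * √((1 / 2) * Real.log (1 / δ)) *
          √(1 / (I.card : ℝ)) < lipDev (condLaw Q y) I x} with hA
        have hAm : MeasurableSet A :=
          measurableSet_lt measurable_const (measurable_lipDev _ hD hne)
        have hfst : ∀ i, IsProbabilityMeasure ((Q[|{p | p.2 = v i}]).map Prod.fst) := fun i =>
          Measure.isProbabilityMeasure_map measurable_fst.aemeasurable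
        have hmp : MeasurePreserving (fun (z : Fin n → X × Y) i => (z i).1)
            (Measure.pi fun i => Q[|{p | p.2 = v i}])
            (Measure.pi fun i => (Q[|{p | p.2 = v i}]).map Prod.fst) :=
          measurePreserving_pi _ _ fun i => ⟨measurable_fst, rfl⟩
        have hsub : bad ∩ S v ⊆ (fun (z : Fin n → X × Y) i => (z i).1) ⁻¹' A ∩ S v := by
          rintro z ⟨hz, hzS⟩
          refine ⟨?_, hzS⟩
          have h2 := hz.2
          rw [hidx z hzS] at h2
          exact h2
        calc P (bad ∩ S v) ≤ P ((fun (z : Fin n → X × Y) i => (z i).1) ⁻¹' A ∩ S v) :=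
              measure_mono hsub
          _ = P.restrict (S v) ((fun (z : Fin n → X × Y) i => (z i).1) ⁻¹' A) :=
              (Measure.restrict_apply (hmp.measurable hAm)).symm
          _ = P (S v) * Measure.pi (fun i => (Q[|{p | p.2 = v i}]).map Prod.fst) A := by
              rw [hP, hS, restrict_labels_eq Q v hv, Measure.smul_apply, smul_eq_mul,
                hmp.measure_preimage hAm.nullMeasurableSet, Measure.pi_pi]
          _ ≤ P (S v) * ENNReal.ofReal δ := by
              gcongr
              exact measure_lipDev_gt_le (condLaw Q y) hD hD0 _ hne
                (hm I _ hne fun i hi => by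
                  rw [(Finset.mem_filter.1 hi).2]
                  rfl) hδ hδ1
          _ = _ := mul_comm _ _
      · push Not at hv
        obtain ⟨i, hi⟩ := hv
        have h0 : P (S v) = 0 := by
          rw [hPS]
          exact Finset.prod_eq_zero (Finset.mem_univ i) hi
        exact (measure_mono Set.inter_subset_right).trans (by simp [h0])
    · have : bad ∩ S v = ∅ := by
        ext z
        simp only [Set.mem_inter_iff, Set.mem_empty_iff_false, iff_false, not_and]
        intro hz hzS
        have h1 := hz.1
        rw [hidx z hzS] at h1
        exact hne h1
      simp [this]
  calc P bad ≤ P (⋃ v, bad ∩ S v) := measure_mono hcover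
    _ ≤ ∑ v, P (bad ∩ S v) := measure_iUnion_fintype_le _ _
    _ ≤ ∑ v, ENNReal.ofReal δ * P (S v) := Finset.sum_le_sum fun v _ => hkey v
    _ = ENNReal.ofReal δ := by rw [← Finset.mul_sum, hone, mul_one]

end ClassConditional

/-! ### Empirical label frequencies. -/

section LabelFrequencies

variable {X Y : Type*} [MeasurableSpace X] [Fintype Y] [DecidableEq Y] [MeasurableSpace Y]
  [MeasurableSingletonClass Y]

lemma classCount_eq_sum {n : ℕ} (z : Fin n → X × Y) (y : Y) :
    (classCount z y : ℝ) = ∑ i, {p : X × Y | p.2 = y}.indicator (1 : X × Y → ℝ) (z i) := by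
  classical
  simp [classCount, Set.indicator_apply]

/-- The total deficit of the empirical label frequencies. -/
def labelDev (Q : Measure (X × Y)) {n : ℕ} (z : Fin n → X × Y) : ℝ :=
  ∑ y, max 0 (labelMass Q y - classCount z y / n)

variable (Q : Measure (X × Y)) [IsProbabilityMeasure Q]

lemma measurable_label_indicator (y : Y) :
    Measurable ({p : X × Y | p.2 = y}.indicator (1 : X × Y → ℝ)) :=
  measurable_one.indicator (measurableSet_label y)

lemma measurable_labelDev {n : ℕ} : Measurable (labelDev Q (n := n)) := by
  unfold labelDev
  simp_rw [classCount_eq_sum]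
  have := measurable_label_indicator (X := X) (Y := Y)
  fun_prop

lemma abs_labelDev_le {n : ℕ} (z : Fin n → X × Y) : |labelDev Q z| ≤ Fintype.card Y := by
  rw [abs_of_nonneg (Finset.sum_nonneg fun y _ => le_max_left _ _)]
  calc _ ≤ ∑ _y : Y, (1 : ℝ) := by
        refine Finset.sum_le_sum fun y _ => max_le zero_le_one ?_
        have h1 : labelMass Q y ≤ 1 := measureReal_le_one
        have h2 : (0 : ℝ) ≤ classCount z y / n := by positivity
        linarith
    _ = _ := by simp

/-- Only the label that loses a point can increase its deficit. Counting deficits alone gives `1 /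
n` where the full `ℓ¹` deviation would give `2 / n`. -/
lemma labelDev_update_sub_le {n : ℕ} (i : Fin n) (z : Fin n → X × Y) (p : X × Y) :
    labelDev Q (Function.update z i p) - labelDev Q z ≤ 1 / n := by
  have h1 : ∀ y, (classCount z y : ℝ) ≤ classCount (Function.update z i p) y +
      if (z i).2 = y then 1 else 0 := fun y => by
    rw [classCount_eq_sum, classCount_eq_sum, ← Finset.add_sum_erase _ _ (Finset.mem_univ i),
      ← Finset.add_sum_erase _ (fun j => {p : X × Y | p.2 = y}.indicator (1 : X × Y → ℝ)
        (Function.update z i p j)) (Finset.mem_univ i)]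
    have h3 : ∑ j ∈ Finset.univ.erase i, {p : X × Y | p.2 = y}.indicator (1 : X × Y → ℝ)
        (Function.update z i p j) =
        ∑ j ∈ Finset.univ.erase i, {p : X × Y | p.2 = y}.indicator (1 : X × Y → ℝ) (z j) :=
      Finset.sum_congr rfl fun j hj => by
        rw [Function.update_of_ne (Finset.ne_of_mem_erase hj)]
    rw [h3]
    have h4 : 0 ≤ {p : X × Y | p.2 = y}.indicator (1 : X × Y → ℝ) (Function.update z i p i) :=
      Set.indicator_nonneg (fun _ _ => zero_le_one) _
    have h5 : {p : X × Y | p.2 = y}.indicator (1 : X × Y → ℝ) (z i) =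
        if (z i).2 = y then 1 else 0 := by
      classical
      simp [Set.indicator_apply]
    linarith
  rw [sub_le_iff_le_add]
  calc labelDev Q (Function.update z i p)
      ≤ ∑ y, (max 0 (labelMass Q y - classCount z y / n) + if (z i).2 = y then 1 / (n : ℝ) else 0) := by
        refine Finset.sum_le_sum fun y _ => ?_
        have h2 : (classCount z y : ℝ) / n ≤ classCount (Function.update z i p) y / n +
            if (z i).2 = y then 1 / (n : ℝ) else 0 := by
          calc _ ≤ ((classCount (Function.update z i p) y : ℝ) +
                if (z i).2 = y then 1 else 0) / n := by
                gcongr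
                exact h1 y
            _ = _ := by split_ifs <;> ring
        have h3 : (0 : ℝ) ≤ if (z i).2 = y then 1 / (n : ℝ) else 0 := by
          split_ifs <;> positivity
        refine max_le (add_nonneg (le_max_left _ _) h3) ?_
        have := le_max_right 0 (labelMass Q y - classCount z y / n)
        linarith
    _ = _ := by
        rw [Finset.sum_add_distrib, add_comm]
        simp [labelDev]

lemma integral_labelDev_le {n : ℕ} (hn : 0 < n) :
    ∫ z, labelDev Q z ∂(Measure.pi fun _ : Fin n => Q) ≤ Fintype.card Y * (1 / √n) := by
  have hne : (Finset.univ : Finset (Fin n)).Nonempty := ⟨⟨0, hn⟩, Finset.mem_univ _⟩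
  have h01 : ∀ (y : Y) p, {p : X × Y | p.2 = y}.indicator (1 : X × Y → ℝ) p ∈ Set.Icc (0 : ℝ) 1 :=
    fun y p => by
      by_cases hp : p ∈ {p : X × Y | p.2 = y} <;> simp [hp]
  have hdev : ∀ y, ∫ z, |(classCount z y : ℝ) / n - labelMass Q y|
      ∂(Measure.pi fun _ : Fin n => Q) ≤ 1 / √n := fun y => by
    have := integral_abs_sum_div_sub_le (fun _ : Fin n => Q) hne
      (measurable_label_indicator y) (h01 y) (p := labelMass Q y)
      fun i _ => by rw [integral_indicator_one (measurableSet_label y)]; rfl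
    simp only [Finset.card_univ, Fintype.card_fin, ← classCount_eq_sum] at this
    simpa only [one_div_mul_eq_div] using this
  have hint : ∀ y, Integrable (fun z : Fin n → X × Y => |(classCount z y : ℝ) / n - labelMass Q y|)
      (Measure.pi fun _ : Fin n => Q) := fun y => by
    refine Integrable.of_bound (Measurable.aestronglyMeasurable ?_) 1 (ae_of_all _ fun z => ?_)
    · simp_rw [classCount_eq_sum]
      have := measurable_label_indicator (X := X) (Y := Y)
      fun_prop
    · have h1 : labelMass Q y ≤ 1 := measureReal_le_one
      have h2 : 0 ≤ labelMass Q y := measureReal_nonneg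
      have h3 : (0 : ℝ) ≤ classCount z y / n := by positivity
      have h4 : (classCount z y : ℝ) / n ≤ 1 := by
        rw [div_le_one (by exact_mod_cast hn)]
        have : classCount z y ≤ n := by
          simpa [classCount] using Finset.card_filter_le (Finset.univ : Finset (Fin n)) _
        exact_mod_cast this
      rw [Real.norm_eq_abs, abs_abs, abs_le]
      constructor <;> linarith
  calc _ ≤ ∫ z, ∑ y, |(classCount z y : ℝ) / n - labelMass Q y|
        ∂(Measure.pi fun _ : Fin n => Q) := by
        refine integral_mono (Integrable.of_bound (measurable_labelDev Q).aestronglyMeasurable _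
          (ae_of_all _ (abs_labelDev_le Q))) (integrable_finsetSum _ fun y _ => hint y) fun z => ?_
        refine Finset.sum_le_sum fun y _ => max_le (abs_nonneg _) ?_
        rw [abs_sub_comm]
        exact le_abs_self _
    _ ≤ ∑ _y : Y, 1 / √(n : ℝ) := by
        rw [integral_finsetSum _ fun y _ => hint y]
        exact Finset.sum_le_sum fun y _ => hdev y
    _ = _ := by simp

/-- Concentration of the empirical label frequencies. -/
theorem measure_labelDev_gt_le {n : ℕ} (hn : 0 < n) {δ : ℝ} (hδ : 0 < δ) (hδ1 : δ ≤ 1) :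
    (Measure.pi fun _ : Fin n => Q)
      {z | Fintype.card Y * (1 / √n) + √(Real.log (1 / δ) / (2 * n)) < labelDev Q z} ≤
      ENNReal.ofReal δ := by
  have hn0 : (0 : ℝ) < n := by exact_mod_cast hn
  have h := hasSubgaussianMGF_pi_of_bounded_differences (fun _ : Fin n => Q)
    (measurable_labelDev Q) (abs_labelDev_le Q) (fun _ => 1 / n)
    fun i z p => (labelDev_update_sub_le Q i z p).trans (by simp)
  refine (measure_mono ?_).trans (HasSubgaussianMGF.measure_gt_le h hδ hδ1)
  intro z hz
  rw [Set.mem_ofPred_eq] at hz ⊢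
  have hc : 2 * ((∑ _i : Fin n, (1 / (n : ℝ≥0) / 2) ^ 2 : ℝ≥0) : ℝ) * Real.log (1 / δ) =
      Real.log (1 / δ) / (2 * n) := by
    push_cast
    simp only [Finset.sum_const, Finset.card_univ, Fintype.card_fin, nsmul_eq_mul]
    field_simp
  rw [hc]
  have := integral_labelDev_le Q hn
  linarith

end LabelFrequencies

/-! ### Wasserstein distance and Lipschitz test functions. -/

section Wasserstein

variable {X : Type*} [MetricSpace X] [SecondCountableTopology X] [MeasurableSpace X] [BorelSpace X]
  {D : ℝ} (hD : ∀ x y : X, dist x y ≤ D)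

include hD

lemma lintegral_edist_le (γ : Measure (X × X)) [IsProbabilityMeasure γ] :
    ∫⁻ p, edist p.1 p.2 ∂γ ≤ ENNReal.ofReal D := by
  calc _ ≤ ∫⁻ _, ENNReal.ofReal D ∂γ := lintegral_mono fun p => by
        rw [edist_dist]
        exact ENNReal.ofReal_le_ofReal (hD _ _)
    _ = _ := by simp

lemma wasserstein1_le (μ ν : Measure X) [IsProbabilityMeasure μ] [IsProbabilityMeasure ν] :
    wasserstein1 μ ν ≤ ENNReal.ofReal D :=
  (iInf₂_le (μ.prod ν) ⟨by simp, by simp⟩).trans (lintegral_edist_le hD _)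

/-- The easy half of Kantorovich duality. -/
lemma integral_sub_integral_le_wasserstein1 (μ ν : Measure X) [IsProbabilityMeasure μ]
    [IsProbabilityMeasure ν] {K : ℝ≥0} {f : X → ℝ} (hf : LipschitzWith K f) :
    (∫ x, f x ∂μ) - ∫ x, f x ∂ν ≤ K * (wasserstein1 μ ν).toReal := by
  have hfm : AEStronglyMeasurable f μ := hf.continuous.measurable.aestronglyMeasurable
  have hfm' : AEStronglyMeasurable f ν := hf.continuous.measurable.aestronglyMeasurable
  have key : ∀ γ : Measure (X × X), γ.map Prod.fst = μ → γ.map Prod.snd = ν →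
      (∫ x, f x ∂μ) - ∫ x, f x ∂ν ≤ K * (∫⁻ p, edist p.1 p.2 ∂γ).toReal := by
    intro γ h1 h2
    have hγ : IsProbabilityMeasure γ := by
      have : IsProbabilityMeasure (γ.map Prod.fst) := h1 ▸ inferInstance
      exact Measure.isProbabilityMeasure_of_map (f := Prod.fst)
    have e1 : ∫ x, f x ∂μ = ∫ p, f p.1 ∂γ := by
      rw [← h1] at hfm ⊢
      exact integral_map measurable_fst.aemeasurable hfm
    have e2 : ∫ x, f x ∂ν = ∫ p, f p.2 ∂γ := by
      rw [← h2] at hfm' ⊢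
      exact integral_map measurable_snd.aemeasurable hfm'
    have i1 : Integrable (fun p : X × X => f p.1) γ :=
      (MeasurePreserving.mk measurable_fst h1).integrable_comp_of_integrable
        (integrable_of_lipschitz μ hD hf)
    have i2 : Integrable (fun p : X × X => f p.2) γ :=
      (MeasurePreserving.mk measurable_snd h2).integrable_comp_of_integrable
        (integrable_of_lipschitz ν hD hf)
    have hdm : Measurable fun p : X × X => dist p.1 p.2 := continuous_dist.measurable
    have i3 : Integrable (fun p : X × X => dist p.1 p.2) γ :=
      Integrable.of_bound hdm.aestronglyMeasurable D (ae_of_all _ fun p => by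
        rw [Real.norm_eq_abs, abs_of_nonneg dist_nonneg]
        exact hD _ _)
    have e3 : (∫⁻ p, edist p.1 p.2 ∂γ).toReal = ∫ p, dist p.1 p.2 ∂γ := by
      rw [integral_eq_lintegral_of_nonneg_ae (ae_of_all _ fun p => dist_nonneg)
        hdm.aestronglyMeasurable]
      simp_rw [edist_dist]
    rw [e1, e2, e3, ← integral_sub i1 i2, ← integral_const_mul]
    refine integral_mono (i1.sub i2) (i3.const_mul _) fun p => ?_
    have := hf.dist_le_mul p.1 p.2
    rw [Real.dist_eq] at this
    exact (le_abs_self _).trans this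
  rcases eq_or_ne K 0 with rfl | hK
  · simpa using key (μ.prod ν) (by simp) (by simp)
  · have hK0 : (0 : ℝ) < K := by positivity
    have hfin : wasserstein1 μ ν ≠ ⊤ :=
      ((wasserstein1_le hD μ ν).trans_lt ENNReal.ofReal_lt_top).ne
    rw [mul_comm, ← div_le_iff₀ hK0, ← ENNReal.ofReal_le_iff_le_toReal hfin]
    refine le_iInf₂ fun γ hγ => ENNReal.ofReal_le_of_le_toReal ?_
    rw [div_le_iff₀ hK0, mul_comm]
    exact key γ hγ.1 hγ.2

/-- Rescaling by `K⁻¹` reduces to 1-Lipschitz functions; for `K = 0` the function is constant. -/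
lemma average_sub_integral_le_lipDev (μ : Measure X) [IsProbabilityMeasure μ] {K : ℝ≥0} {f : X → ℝ}
    (hf : LipschitzWith K f) {n : ℕ} {I : Finset (Fin n)} (hI : I.Nonempty) (x : Fin n → X) :
    (1 / (I.card : ℝ)) * (∑ i ∈ I, f (x i)) - ∫ x, f x ∂μ ≤ K * lipDev μ I x := by
  have hk0 : (0 : ℝ) < I.card := by exact_mod_cast hI.card_pos
  rcases eq_or_ne K 0 with rfl | hK
  · obtain ⟨i, -⟩ := id hI
    obtain ⟨c, rfl⟩ : ∃ c, f = fun _ => c := ⟨f (x i), funext fun a => by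
      have := hf.dist_le_mul a (x i)
      rw [NNReal.coe_zero, zero_mul] at this
      exact dist_le_zero.1 this⟩
    have : (1 / (I.card : ℝ)) * (∑ _i ∈ I, c) - ∫ _, c ∂μ = 0 := by
      simp only [Finset.sum_const, nsmul_eq_mul, integral_const, probReal_univ, smul_eq_mul]
      field_simp
      simp
    rw [this, NNReal.coe_zero, zero_mul]
  · have hK0 : (0 : ℝ) < K := by positivity
    have hg : LipschitzWith 1 fun a => (K : ℝ)⁻¹ * f a := by
      refine LipschitzWith.of_dist_le_mul fun a b => ?_
      have := hf.dist_le_mul a b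
      rw [Real.dist_eq, ← mul_sub, abs_mul, abs_of_pos (inv_pos.2 hK0), ← Real.dist_eq,
        NNReal.coe_one, one_mul, inv_mul_le_iff₀ hK0]
      exact this
    have := le_lipDev μ hD hg hI x
    rw [← Finset.mul_sum, integral_const_mul] at this
    calc _ = K * ((1 / (I.card : ℝ)) * ((K : ℝ)⁻¹ * ∑ i ∈ I, f (x i)) -
          (K : ℝ)⁻¹ * ∫ x, f x ∂μ) := by field_simp
      _ ≤ _ := by gcongr

variable {Y : Type*} [DecidableEq Y] [MeasurableSpace Y]

omit hD in
lemma isProbabilityMeasure_empCond {n : ℕ} {z : Fin n → X × Y} {y : Y} (h : 0 < classCount z y) :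
    IsProbabilityMeasure (empCond z y) := by
  constructor
  simp only [empCond, Measure.smul_apply, Measure.coe_finsetSum, Finset.sum_apply, measure_univ,
    Finset.sum_const, nsmul_eq_mul, mul_one, smul_eq_mul]
  exact ENNReal.inv_mul_cancel (by simpa using h.ne') (ENNReal.natCast_ne_top _)

omit hD in
lemma integral_empCond {n : ℕ} (z : Fin n → X × Y) (y : Y) (f : X → ℝ) :
    ∫ x, f x ∂(empCond z y) =
      (1 / ((classIdx z y).card : ℝ)) * ∑ i ∈ classIdx z y, f (z i).1 := by
  rw [empCond, integral_smul_measure, integral_finsetSum_measure fun i _ =>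
    integrable_dirac (by simp)]
  simp [classCount, classIdx]

/-- The gap between target and source class conditionals on a Lipschitz function. -/
lemma integral_condLaw_sub_le (Q S : Measure (X × Y)) {y : Y} [IsProbabilityMeasure (condLaw Q y)]
    [IsProbabilityMeasure (condLaw S y)] {K : ℝ≥0} {f : X → ℝ} (hf : LipschitzWith K f) {n m : ℕ}
    {zQ : Fin m → X × Y} {zS : Fin n → X × Y} (hQ : 0 < classCount zQ y)
    (hS : 0 < classCount zS y) :
    (∫ x, f x ∂(condLaw Q y)) - ∫ x, f x ∂(condLaw S y) ≤
      K * (lipDev (condLaw Q y) (classIdx zQ y) (fun i => (zQ i).1) + empW1 zQ zS y +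
        lipDev (condLaw S y) (classIdx zS y) fun i => (zS i).1) := by
  have := isProbabilityMeasure_empCond hQ
  have := isProbabilityMeasure_empCond hS
  -- `lipDev` is one-sided (average minus integral), so the target leg uses `-f`.
  have h1 := average_sub_integral_le_lipDev hD (condLaw Q y) hf.neg (Finset.card_pos.1 hQ)
    fun i => (zQ i).1
  have h2 := average_sub_integral_le_lipDev hD (condLaw S y) hf (Finset.card_pos.1 hS)
    fun i => (zS i).1
  have h3 := integral_sub_integral_le_wasserstein1 hD (empCond zQ y) (empCond zS y) hf
  rw [integral_empCond, integral_empCond] at h3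
  simp only [Finset.sum_neg_distrib, integral_neg, Pi.neg_apply] at h1
  simp only [classIdx, empW1] at *
  rw [mul_add, mul_add]
  linarith

end Wasserstein

/-! ### Concentration of the weighted sum over sources. -/

section WeightedDeviation

variable {ι Z : Type*} [TopologicalSpace Z] [SecondCountableTopology Z] [MeasurableSpace Z]
  [BorelSpace Z]

/-- The weighted sum of the uniform deviations on independent samples. -/
theorem measure_sum_uniformDev_gt_le {T : ℕ} (S : Fin T → Measure Z)
    [∀ t, IsProbabilityMeasure (S t)] {g : Fin T → ι → Z → ℝ} {B : ℝ≥0}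
    (hc : ∀ t h, Continuous (g t h)) (hg : ∀ t h p, 0 ≤ g t h p ∧ g t h p ≤ B) {N : Fin T → ℕ}
    (hN : ∀ t, 0 < N t) {w : Fin T → ℝ} (hw : ∀ t, 0 ≤ w t) {δ : ℝ} (hδ : 0 < δ) (hδ1 : δ ≤ 1) :
    (Measure.pi fun t => Measure.pi fun _ : Fin (N t) => S t)
      {z | ∑ t, w t * (2 * radComplexity (S t) (g t) (N t)) +
        B * √(∑ t, w t ^ 2 / ((N t : ℝ) / ∑ u, (N u : ℝ))) *
          √(Real.log (1 / δ) / (2 * ∑ u, (N u : ℝ))) <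
        ∑ t, w t * uniformDev (S t) (g t) (z t)} ≤ ENNReal.ofReal δ := by
  have hg' : ∀ t h p, |g t h p| ≤ B := fun t h p => by
    rw [abs_of_nonneg (hg t h p).1]
    exact (hg t h p).2
  set P : ∀ t, Measure (Fin (N t) → Z) := fun t => Measure.pi fun _ : Fin (N t) => S t with hP
  set U : ∀ t, (Fin (N t) → Z) → ℝ := fun t z =>
    w t * (uniformDev (S t) (g t) z - ∫ z, uniformDev (S t) (g t) z ∂(P t)) with hU
  have hUm : ∀ t, Measurable (U t) := fun t =>
    ((measurable_uniformDev (S t) (hc t) (hg' t) B.2).sub_const _).const_mul _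
  have hUs : ∀ t, HasSubgaussianMGF (fun z : ∀ t, Fin (N t) → Z => U t (z t))
      (⟨w t ^ 2, sq_nonneg _⟩ * (N t * (B / N t / 2) ^ 2)) (Measure.pi P) := fun t => by
    have h := (hasSubgaussianMGF_uniformDev (S t) (hc t) (hg t) (N t)).const_mul (w t)
    have he := measurePreserving_eval P t
    change HasSubgaussianMGF (U t) _ (P t) at h
    rw [← he.map_eq] at h
    exact HasSubgaussianMGF.of_map (X := U t) (Y := Function.eval t) he.measurable.aemeasurable h
  have hsum := HasSubgaussianMGF.sum_of_iIndepFun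
    (iIndepFun_pi (μ := P) fun t => (hUm t).aemeasurable) (s := Finset.univ) fun t _ => hUs t
  refine (measure_mono ?_).trans (HasSubgaussianMGF.measure_gt_le hsum hδ hδ1)
  intro z hz
  rw [Set.mem_ofPred_eq] at hz ⊢
  have hlog : 0 ≤ Real.log (1 / δ) := Real.log_nonneg (by rw [le_div_iff₀ hδ]; linarith)
  have hsN : 0 ≤ ∑ u, (N u : ℝ) := Finset.sum_nonneg fun u _ => by positivity
  -- The variance proxies of the independent sources add up to `∑ w_t² B² / (4 N_t)`, and `1/N_t =
  -- 1/(β_t N)`.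
  have hsqrt : √(2 * ((∑ t, ⟨w t ^ 2, sq_nonneg _⟩ * ((N t : ℝ≥0) * (B / N t / 2) ^ 2) : ℝ≥0) : ℝ) *
      Real.log (1 / δ)) = B * √(∑ t, w t ^ 2 / ((N t : ℝ) / ∑ u, (N u : ℝ))) *
          √(Real.log (1 / δ) / (2 * ∑ u, (N u : ℝ))) := by
    have h1 : 0 ≤ ∑ t, w t ^ 2 / ((N t : ℝ) / ∑ u, (N u : ℝ)) :=
      Finset.sum_nonneg fun t _ => by positivity
    conv_rhs => rw [← Real.sqrt_sq B.coe_nonneg, ← Real.sqrt_mul (by positivity),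
      ← Real.sqrt_mul (mul_nonneg (by positivity) h1)]
    congr 1
    push_cast
    change 2 * (∑ t, w t ^ 2 * ((N t : ℝ) * ((B : ℝ) / N t / 2) ^ 2)) * Real.log (1 / δ) = _
    rw [Finset.mul_sum, Finset.sum_mul, Finset.mul_sum, Finset.sum_mul]
    refine Finset.sum_congr rfl fun t _ => ?_
    have h2 : (0 : ℝ) < N t := by exact_mod_cast hN t
    have h3 : 0 < ∑ u, (N u : ℝ) :=
      h2.trans_le (Finset.single_le_sum (f := fun u => (N u : ℝ))
        (fun u _ => by positivity) (Finset.mem_univ t))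
    field_simp
  rw [hsqrt]
  have hE : ∑ t, w t * ∫ z, uniformDev (S t) (g t) z ∂(P t) ≤
      ∑ t, w t * (2 * radComplexity (S t) (g t) (N t)) :=
    Finset.sum_le_sum fun t _ => mul_le_mul_of_nonneg_left
      (integral_uniformDev_le (S t) (hc t) (hg' t) B.2 (hN t)) (hw t)
  simp only [hU, mul_sub, Finset.sum_sub_distrib]
  linarith

end WeightedDeviation

/-! ### Decomposition of expectations over labels. -/

section LabelDecomposition

variable {X Y : Type*} [MeasurableSpace X] [Fintype Y] [MeasurableSpace Y]
  [MeasurableSingletonClass Y] (Q : Measure (X × Y)) [IsProbabilityMeasure Q]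

lemma setIntegral_label_eq {g : X × Y → ℝ} (hg : Measurable g) (y : Y) :
    ∫ p in {p | p.2 = y}, g p ∂Q = labelMass Q y * ∫ x, g (x, y) ∂(condLaw Q y) := by
  have hm : MeasurableSet {p : X × Y | p.2 = y} := measurable_snd (measurableSet_singleton y)
  have hgy : Measurable fun x => g (x, y) := hg.comp (measurable_id.prodMk measurable_const)
  rw [condLaw, integral_map measurable_fst.aemeasurable hgy.aestronglyMeasurable,
    ProbabilityTheory.cond, integral_smul_measure]
  have h1 : ∫ p in {p | p.2 = y}, g (p.1, y) ∂Q = ∫ p in {p | p.2 = y}, g p ∂Q :=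
    setIntegral_congr_fun hm fun p hp => by
      rw [← (hp : p.2 = y)]
  rw [h1, labelMass, Measure.real, smul_eq_mul, ← mul_assoc, ENNReal.toReal_inv]
  rcases eq_or_ne (Q {p | p.2 = y}) 0 with h0 | h0
  · rw [Measure.restrict_eq_zero.2 h0]
    simp
  · rw [mul_inv_cancel₀ (ENNReal.toReal_ne_zero.2 ⟨h0, measure_ne_top _ _⟩), one_mul]

/-- The law of total expectation over the labels. -/
lemma integral_eq_sum_labels {g : X × Y → ℝ} (hg : Measurable g) (hgi : Integrable g Q) :
    ∫ p, g p ∂Q = ∑ y, labelMass Q y * ∫ x, g (x, y) ∂(condLaw Q y) := by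
  have hm : ∀ y, MeasurableSet {p : X × Y | p.2 = y} := fun y =>
    measurable_snd (measurableSet_singleton y)
  have hU : ⋃ y, {p : X × Y | p.2 = y} = Set.univ := by
    ext p
    simp
  rw [← setIntegral_univ, ← hU, integral_iUnion_fintype hm
    (fun a b hab => Set.disjoint_left.2 fun p h1 h2 => hab ((h1 : p.2 = a).symm.trans h2))
    fun y => hgi.integrableOn]
  exact Finset.sum_congr rfl fun y _ => setIntegral_label_eq Q hg y

end LabelDecomposition

/-! ### Monotonicity of the complexity term. -/

section Comp

lemma kappa_anti {C s D : ℝ} (hC : 0 ≤ C) (hs : 0 ≤ s) (hD : 0 ≤ D) (T c : ℕ) (δ : ℝ)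
    {k k' m m' : ℕ} (hk : 0 < k) (hm : 0 < m) (hkk : k ≤ k') (hmm : m ≤ m') :
    kappa C s D T c δ k' m' ≤ kappa C s D T c δ k m := by
  have hk0 : (0 : ℝ) < k := by exact_mod_cast hk
  have hm0 : (0 : ℝ) < m := by exact_mod_cast hm
  have hkk' : (k : ℝ) ≤ k' := by exact_mod_cast hkk
  have hmm' : (m : ℝ) ≤ m' := by exact_mod_cast hmm
  have hs' : -(1 / s) ≤ 0 := by
    rw [neg_nonpos]
    positivity
  have h1 := Real.rpow_le_rpow_of_nonpos hk0 hkk' hs'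
  have h2 := Real.rpow_le_rpow_of_nonpos hm0 hmm' hs'
  unfold kappa
  gcongr

variable {X Y : Type*} [MeasurableSpace X] [MeasurableSpace Y] [Fintype Y] {T : ℕ}

lemma comp_anti (S : Fin T → Measure (X × Y)) (Q : Measure (X × Y)) {ℓ : ℝ → ℝ}
    {H : Set (X → Y → ℝ)} {LK C s D Cmax δ : ℝ} {N N' : Fin T → ℕ} {M M' : ℕ}
    {k k' : Fin T → Y → ℕ} {m m' : Y → ℕ}
    (hrad : ∀ t, rademacher (S t) (labelRatio (S t) Q) ℓ H (N' t) ≤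
      rademacher (S t) (labelRatio (S t) Q) ℓ H (N t))
    (hLK : 0 ≤ LK) (hC : 0 ≤ C) (hs : 0 ≤ s) (hD : 0 ≤ D) (hCmax : 0 ≤ Cmax) (hδ : 0 < δ)
    (hδ1 : δ < 1) (hM : 0 < M)
    (hpos : ∀ y, 0 < labelMass Q y → 0 < m y ∧ ∀ t, 0 < k t y)
    (hMM : M ≤ M') (hk : k ≤ k') (hm : m ≤ m') :
    comp S Q ℓ H LK C s D Cmax N' M' k' m' δ ≤ comp S Q ℓ H LK C s D Cmax N M k m δ := by
  have hM0 : (0 : ℝ) < M := by exact_mod_cast hM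
  have hMM' : (M : ℝ) ≤ M' := by exact_mod_cast hMM
  have hlog1 : 0 ≤ Real.log (2 * Fintype.card Y) := by
    exact_mod_cast Real.log_natCast_nonneg (2 * Fintype.card Y)
  have hlog2 : 0 ≤ Real.log (T / δ) := by
    rcases Nat.eq_zero_or_pos T with h | h
    · simp [h]
    · refine Real.log_nonneg ?_
      rw [le_div_iff₀ hδ]
      have : (1 : ℝ) ≤ T := by exact_mod_cast h
      linarith
  unfold comp
  refine add_le_add (mul_le_mul_of_nonneg_left (ciSup_mono (Set.finite_range _).bddAbove hrad)
    zero_le_two) (mul_le_mul_of_nonneg_left (add_le_add (ciSup_mono (Set.finite_range _).bddAbove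
      fun p => ?_) ?_) hLK)
  · exact kappa_anti hC hs hD T _ δ ((hpos _ p.2.2).2 _) (hpos _ p.2.2).1 (hk _ _) (hm _)
  · gcongr

end Comp

/-! ### From the target risk to the reweighted source risk. -/

section Gap

variable {X Y : Type*} [MetricSpace X] [SecondCountableTopology X] [MeasurableSpace X]
  [BorelSpace X] [Fintype Y] [DecidableEq Y] [MeasurableSpace Y] [MeasurableSingletonClass Y]

/-- Enlarging the constant in `kappa` absorbs the mean deviation of the label frequencies. -/
lemma kappa_add_le {C s D Cmax : ℝ} (hs : 2 ≤ s) (hD : 0 ≤ D) (hCD : Cmax ≤ D)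
    {T c k m M : ℕ} {δ : ℝ} (hm : 0 < m) (hmM : m ≤ M) :
    kappa C s D T c δ k m + Cmax * (c * (1 / √M)) ≤ kappa (C + D * c + 1) s D T c δ k m := by
  have hm0 : (0 : ℝ) < m := by exact_mod_cast hm
  have hmM' : (m : ℝ) ≤ M := by exact_mod_cast hmM
  have hM1 : (1 : ℝ) ≤ M := by exact_mod_cast hm.trans_le hmM
  -- Here `s ≥ 2` and `m ≤ M` enter.
  have h1 : 1 / √(M : ℝ) ≤ (m : ℝ) ^ (-(1 / s)) := by
    calc 1 / √(M : ℝ) = (M : ℝ) ^ (-(1 / 2 : ℝ)) := by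
          rw [Real.sqrt_eq_rpow, Real.rpow_neg (by linarith), one_div]
      _ ≤ (M : ℝ) ^ (-(1 / s)) := by
          refine Real.rpow_le_rpow_of_exponent_le hM1 ?_
          rw [neg_le_neg_iff]
          gcongr
      _ ≤ (m : ℝ) ^ (-(1 / s)) := by
          refine Real.rpow_le_rpow_of_nonpos hm0 hmM' ?_
          rw [neg_nonpos]
          positivity
  have h2 : Cmax * (c * (1 / √(M : ℝ))) ≤ D * (c * (m : ℝ) ^ (-(1 / s))) := by gcongr
  have h3 : (0 : ℝ) ≤ (D * c + 1) * (k : ℝ) ^ (-(1 / s)) := by positivity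
  have h4 : (0 : ℝ) ≤ (m : ℝ) ^ (-(1 / s)) := by positivity
  unfold kappa
  linarith

/-- The gap between the target risk and the reweighted source risk, on samples whose class
conditionals and label frequencies are close to the true ones. -/
lemma integral_sub_integral_ratio_le {D : ℝ} (hD : ∀ x y : X, dist x y ≤ D) (hD0 : 0 ≤ D)
    (S Q : Measure (X × Y)) [IsProbabilityMeasure S] [IsProbabilityMeasure Q]
    (hSQ : ∀ y, labelMass S y = 0 → labelMass Q y = 0) {K : ℝ≥0} {f : X → Y → ℝ} {b : ℝ}
    (hf : ∀ y, LipschitzWith K fun x => f x y) (hfm : Measurable fun p : X × Y => f p.1 p.2)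
    (hfb : ∀ x y, |f x y| ≤ b) {n M : ℕ} {zQ : Fin M → X × Y} {zS : Fin n → X × Y}
    (hpos : ∀ y, 0 < labelMass Q y → 0 < classCount zQ y ∧ 0 < classCount zS y)
    {C s Cmax κ ε δ : ℝ} {T : ℕ} (hs : 2 ≤ s) (hCmax : 0 ≤ Cmax)
    (hW : ∀ y, 0 < labelMass Q y → empW1 zQ zS y ≤ Cmax) (hCD : Cmax ≤ D)
    (hdev : ∀ y, 0 < labelMass Q y →
      lipDev (condLaw Q y) (classIdx zQ y) (fun i => (zQ i).1) +
        lipDev (condLaw S y) (classIdx zS y) (fun i => (zS i).1) ≤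
      kappa C s D T (Fintype.card Y) δ (classCount zS y) (classCount zQ y))
    (hκ : ∀ y, 0 < labelMass Q y → kappa (C + D * Fintype.card Y + 1) s D T (Fintype.card Y) δ
      (classCount zS y) (classCount zQ y) ≤ κ)
    (hlab : labelDev Q zQ ≤ Fintype.card Y * (1 / √M) + ε) :
    (∫ p, f p.1 p.2 ∂Q) - ∫ p, labelRatio S Q p.2 * f p.1 p.2 ∂S ≤
      K * (∑ y, ((classCount zQ y : ℝ) / M) * empW1 zQ zS y) + K * (κ + Cmax * ε) := by
  have hαm : Measurable fun p : X × Y => labelRatio S Q p.2 :=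
    (measurable_of_finite (labelRatio S Q)).comp measurable_snd
  have hfi : ∀ (R : Measure (X × Y)) [IsProbabilityMeasure R],
      Integrable (fun p : X × Y => f p.1 p.2) R := fun R _ =>
    Integrable.of_bound hfm.aestronglyMeasurable b (ae_of_all _ fun p => hfb _ _)
  have hαb : ∀ y, |labelRatio S Q y| ≤ ∑ y, |labelRatio S Q y| := fun y =>
    Finset.single_le_sum (f := fun y => |labelRatio S Q y|) (fun _ _ => abs_nonneg _)
      (Finset.mem_univ y)
  have hS := integral_eq_sum_labels S (g := fun p => labelRatio S Q p.2 * f p.1 p.2) (hαm.mul hfm)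
    ((hfi S).bdd_mul hαm.aestronglyMeasurable (ae_of_all _ fun p => hαb p.2))
  rw [integral_eq_sum_labels Q hfm (hfi Q), hS, ← Finset.sum_sub_distrib]
  have hp0 : ∀ y, 0 ≤ labelMass Q y := fun y => measureReal_nonneg
  have hp1 : ∑ y, labelMass Q y = 1 := by
    simp_rw [labelMass, Measure.real]
    rw [← ENNReal.toReal_sum fun y _ => measure_ne_top _ _, sum_measure_label, ENNReal.toReal_one]
  -- The term `|Y|/√M` is subtracted from `κ` here and cancels against the mean part of `labelDev`
  -- after summation over `y`.
  have hterm : ∀ y, labelMass Q y * ∫ x, f x y ∂(condLaw Q y) -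
      labelMass S y * ∫ x, labelRatio S Q y * f x y ∂(condLaw S y) ≤
      K * ((classCount zQ y : ℝ) / M * empW1 zQ zS y +
        Cmax * max 0 (labelMass Q y - classCount zQ y / M) +
        labelMass Q y * (κ - Cmax * (Fintype.card Y * (1 / √M)))) := by
    intro y
    have hW0 : 0 ≤ empW1 zQ zS y := ENNReal.toReal_nonneg
    rw [integral_const_mul]
    rcases (hp0 y).eq_or_lt with h0 | hy
    · rw [labelRatio, ← h0]
      simp only [zero_mul, zero_div, mul_zero, sub_zero, add_zero]
      positivity
    have hSy : labelMass S y ≠ 0 := fun h => hy.ne' (hSQ y h)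
    have := isProbabilityMeasure_condLaw Q (y := y) fun h => hy.ne' (by simp [labelMass, Measure.real, h])
    have := isProbabilityMeasure_condLaw S (y := y) fun h => hSy (by simp [labelMass, Measure.real, h])
    have h1 : labelMass S y * (labelRatio S Q y * ∫ x, f x y ∂(condLaw S y)) =
        labelMass Q y * ∫ x, f x y ∂(condLaw S y) := by
      rw [labelRatio]
      field_simp
    have h2 := integral_condLaw_sub_le hD Q S (hf y) (hpos y hy).1 (hpos y hy).2
    have hmM : classCount zQ y ≤ M := by
      simpa [classCount] using Finset.card_filter_le (Finset.univ : Finset (Fin M)) _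
    have h3 := kappa_add_le (C := C) (T := T) (c := Fintype.card Y) (k := classCount zS y) (δ := δ)
      hs hD0 hCD (hpos y hy).1 hmM
    have h4 := hdev y hy
    have h5 := hκ y hy
    -- The true mass exceeds the frequency by at most the deficit, and each unit of deficit costs at
    -- most `Cmax`.
    have h6 : labelMass Q y * empW1 zQ zS y ≤ (classCount zQ y : ℝ) / M * empW1 zQ zS y +
        Cmax * max 0 (labelMass Q y - classCount zQ y / M) := by
      have h7 : (labelMass Q y - classCount zQ y / M) * empW1 zQ zS y ≤
          max 0 (labelMass Q y - classCount zQ y / M) * Cmax :=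
        mul_le_mul (le_max_right _ _) (hW y hy) hW0 (le_max_left _ _)
      linarith
    rw [h1, ← mul_sub]
    calc labelMass Q y * ((∫ x, f x y ∂(condLaw Q y)) - ∫ x, f x y ∂(condLaw S y))
        ≤ labelMass Q y * (K * (empW1 zQ zS y +
            (κ - Cmax * (Fintype.card Y * (1 / √M))))) := by
          gcongr
          refine h2.trans (mul_le_mul_of_nonneg_left ?_ K.coe_nonneg)
          linarith
      _ = K * (labelMass Q y * empW1 zQ zS y +
            labelMass Q y * (κ - Cmax * (Fintype.card Y * (1 / √M)))) := by ring
      _ ≤ _ := by gcongr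
  refine (Finset.sum_le_sum fun y _ => hterm y).trans ?_
  rw [← Finset.mul_sum, Finset.sum_add_distrib, Finset.sum_add_distrib, ← Finset.mul_sum,
    ← Finset.sum_mul, hp1, one_mul, ← mul_add]
  refine mul_le_mul_of_nonneg_left ?_ K.coe_nonneg
  have : Cmax * labelDev Q zQ ≤ Cmax * (Fintype.card Y * (1 / √M) + ε) := by gcongr
  unfold labelDev at this
  linarith

end Gap

/-! ### Changing the weights and building the good event. -/

section EmpiricalRisk

variable {X Y : Type*} [Fintype Y]

/-- Each weight difference is at most the Euclidean norm of the difference vector, so the bound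
holds for every sample and every choice of `a`, even data-dependent. -/
lemma empRisk_le_add {n : ℕ} (hn : 0 < n) (z : Fin n → X × Y) (a b : Y → ℝ) {ℓ : ℝ → ℝ} {Lmax : ℝ}
    (hℓ : ∀ a, 0 ≤ ℓ a ∧ ℓ a ≤ Lmax) (h : X → Y → ℝ) :
    empRisk z a ℓ h ≤ empRisk z b ℓ h + Lmax * √(∑ y, (a y - b y) ^ 2) := by
  have hn0 : (0 : ℝ) < n := by exact_mod_cast hn
  have hpt : ∀ y, a y - b y ≤ √(∑ y, (a y - b y) ^ 2) := fun y =>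
    Real.le_sqrt_of_sq_le (Finset.single_le_sum (f := fun y => (a y - b y) ^ 2)
      (fun _ _ => sq_nonneg _) (Finset.mem_univ y))
  have hsum : ∑ i, a (z i).2 * ℓ (h (z i).1 (z i).2) ≤
      (∑ i, b (z i).2 * ℓ (h (z i).1 (z i).2)) + n * (Lmax * √(∑ y, (a y - b y) ^ 2)) := by
    calc _ ≤ ∑ i, (b (z i).2 * ℓ (h (z i).1 (z i).2) + Lmax * √(∑ y, (a y - b y) ^ 2)) := by
          refine Finset.sum_le_sum fun i _ => ?_
          have h1 := hℓ (h (z i).1 (z i).2)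
          have h2 : (a (z i).2 - b (z i).2) * ℓ (h (z i).1 (z i).2) ≤
              √(∑ y, (a y - b y) ^ 2) * Lmax :=
            (mul_le_mul_of_nonneg_right (hpt _) h1.1).trans
              (mul_le_mul_of_nonneg_left h1.2 (Real.sqrt_nonneg _))
          linarith
      _ = _ := by
          rw [Finset.sum_add_distrib]
          simp
  unfold empRisk
  calc _ ≤ (1 / (n : ℝ)) * ((∑ i, b (z i).2 * ℓ (h (z i).1 (z i).2)) +
        n * (Lmax * √(∑ y, (a y - b y) ^ 2))) := by gcongr
    _ = _ := by field_simp

end EmpiricalRisk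

/-- The bad sets are not shown to be measurable; the complement of a measurable hull serves as the
event. -/
lemma exists_event_of_measure_le {Ω : Type*} [MeasurableSpace Ω] (P : Measure Ω)
    [IsProbabilityMeasure P] {bad : Set Ω} {ε : ℝ} (hε : 0 ≤ ε) (h : P bad ≤ ENNReal.ofReal ε) :
    ∃ E, MeasurableSet E ∧ 1 - ε ≤ P.real E ∧ ∀ z ∈ E, z ∉ bad := by
  refine ⟨(toMeasurable P bad)ᶜ, (measurableSet_toMeasurable _ _).compl, ?_, fun z hz hb =>
    hz (subset_toMeasurable P bad hb)⟩
  rw [probReal_compl_eq_one_sub (measurableSet_toMeasurable _ _), Measure.real, measure_toMeasurable]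
  have := ENNReal.toReal_le_of_le_ofReal hε h
  linarith

/-! ### Transfer to the joint law of the data, and the union bound. -/

section Data

variable {X Y : Type*} [MeasurableSpace X] [MeasurableSpace Y] {T : ℕ}
  (S : Fin T → Measure (X × Y)) (Q : Measure (X × Y)) [∀ t, IsProbabilityMeasure (S t)]
  [IsProbabilityMeasure Q] (N : Fin T → ℕ) (M : ℕ)

instance : IsProbabilityMeasure (dataLaw S Q N M) := by
  unfold dataLaw
  infer_instance

lemma dataLaw_preimage_sources_le (s : Set (∀ t, Fin (N t) → X × Y)) :
    dataLaw S Q N M (Prod.fst ⁻¹' s) ≤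
      (Measure.pi fun t => Measure.pi fun _ : Fin (N t) => S t) s := by
  have h := measurePreserving_fst (μ := Measure.pi fun t => Measure.pi fun _ : Fin (N t) => S t)
    (ν := Measure.pi fun _ : Fin M => Q)
  exact (Measure.le_map_apply h.measurable.aemeasurable s).trans (congrArg (· s) h.map_eq).le

lemma dataLaw_preimage_source_le (t : Fin T) (s : Set (Fin (N t) → X × Y)) :
    dataLaw S Q N M {z | z.1 t ∈ s} ≤ (Measure.pi fun _ : Fin (N t) => S t) s := by
  have h := measurePreserving_eval (fun t => Measure.pi fun _ : Fin (N t) => S t) t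
  refine (dataLaw_preimage_sources_le S Q N M {z | z t ∈ s}).trans ?_
  exact (Measure.le_map_apply h.measurable.aemeasurable s).trans (by rw [h.map_eq])

lemma dataLaw_preimage_target_le (s : Set (Fin M → X × Y)) :
    dataLaw S Q N M {z | z.2 ∈ s} ≤ (Measure.pi fun _ : Fin M => Q) s := by
  have h := measurePreserving_snd (μ := Measure.pi fun t => Measure.pi fun _ : Fin (N t) => S t)
    (ν := Measure.pi fun _ : Fin M => Q)
  exact (Measure.le_map_apply h.measurable.aemeasurable s).trans (congrArg (· s) h.map_eq).le

end Data

lemma labelRatio_nonneg {X Y : Type*} [MeasurableSpace X] [MeasurableSpace Y]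
    (S Q : Measure (X × Y)) (y : Y) : 0 ≤ labelRatio S Q y :=
  div_nonneg measureReal_nonneg measureReal_nonneg

section Concentration

variable {X Y : Type*} [MetricSpace X] [SecondCountableTopology X] [MeasurableSpace X]
  [BorelSpace X] [Fintype Y] [DecidableEq Y] [MeasurableSpace Y] [MeasurableSingletonClass Y]
  {T : ℕ} (S : Fin T → Measure (X × Y)) (Q : Measure (X × Y)) [∀ t, IsProbabilityMeasure (S t)]
  [IsProbabilityMeasure Q]

/-- With high probability, the class conditionals and the label frequencies of all samples are
close to the true ones. -/
theorem measure_class_or_label_deviation_le {D : ℝ} (hD : ∀ x y : X, dist x y ≤ D) (hD0 : 0 ≤ D)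
    (hSQ : ∀ t y, labelMass (S t) y = 0 → labelMass Q y = 0) {C s : ℝ}
    (hmean : ∀ (μ : Measure X) [IsProbabilityMeasure μ] (n : ℕ) (I : Finset (Fin n))
      (ν : Fin n → Measure X) [∀ i, IsProbabilityMeasure (ν i)], I.Nonempty →
      (∀ i ∈ I, ν i = μ) → ∫ x, lipDev μ I x ∂(Measure.pi ν) ≤ C * (I.card : ℝ) ^ (-(1 / s)))
    (N : Fin T → ℕ) {M : ℕ} (hM : 0 < M) (hT : 0 < T) {δ : ℝ} (hδ : 0 < δ) (hδ1 : δ < 1) :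
    dataLaw S Q N M {z | ¬ ((∀ t y, 0 < labelMass Q y → 0 < classCount z.2 y →
        0 < classCount (z.1 t) y →
        lipDev (condLaw Q y) (classIdx z.2 y) (fun i => (z.2 i).1) +
          lipDev (condLaw (S t) y) (classIdx (z.1 t) y) (fun i => (z.1 t i).1) ≤
        kappa C s D T (Fintype.card Y) δ (classCount (z.1 t) y) (classCount z.2 y)) ∧
      labelDev Q z.2 ≤ Fintype.card Y * (1 / √M) + √(Real.log (1 / δ) / (2 * M)))} ≤
    ENNReal.ofReal (2 * δ) := by
  set c := Fintype.card Y with hc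
  have hYne : Nonempty Y := by
    by_contra hY
    rw [not_nonempty_iff] at hY
    exact IsProbabilityMeasure.ne_zero Q (Measure.eq_zero_of_isEmpty Q)
  have hc1 : (1 : ℝ) ≤ c := by exact_mod_cast Fintype.card_pos (α := Y)
  have hT1 : (1 : ℝ) ≤ T := by exact_mod_cast hT
  -- With this share, `T * c` source events cost `δ / 2` and `c` target events at most `δ / 2`; `1 /
  -- δ'` is the argument of the logarithm in `kappa`.
  set δ' : ℝ := δ / (2 * T * c) with hδ'
  have hδ'0 : 0 < δ' := by positivity
  have hδ'1 : δ' ≤ 1 := by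
    rw [hδ', div_le_one (by positivity)]
    nlinarith
  set thr : ℕ → ℝ := fun k => C * (k : ℝ) ^ (-(1 / s)) +
    D * √((1 / 2) * Real.log (1 / δ')) * √(1 / (k : ℝ)) with hthr
  set bad : ∀ (R : Measure (X × Y)) (n : ℕ) (y : Y), Set (Fin n → X × Y) := fun R n y =>
    {z | (classIdx z y).Nonempty ∧ thr (classIdx z y).card <
      lipDev (condLaw R y) (classIdx z y) fun i => (z i).1} with hbad
  have hbadle : ∀ (R : Measure (X × Y)) [IsProbabilityMeasure R] (n : ℕ) (y : Y),
      R {p | p.2 = y} ≠ 0 → (Measure.pi fun _ : Fin n => R) (bad R n y) ≤ ENNReal.ofReal δ' := by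
    intro R _ n y hy
    have := isProbabilityMeasure_condLaw R hy
    exact measure_classDev_gt_le hD hD0 R hy (m := fun k => C * (k : ℝ) ^ (-(1 / s)))
      (fun I ν _ hI hν => hmean _ n I ν hI hν) hδ'0 hδ'1
  set lab : Set (Fin M → X × Y) :=
    {z | c * (1 / √M) + √(Real.log (1 / δ) / (2 * M)) < labelDev Q z} with hlab
  have hne : ∀ (R : Measure (X × Y)) y, labelMass R y ≠ 0 → R {p | p.2 = y} ≠ 0 :=
    fun R y h h0 => h (by simp [labelMass, Measure.real, h0])
  have hsub : {z : (∀ t, Fin (N t) → X × Y) × (Fin M → X × Y) |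
      ¬ ((∀ t y, 0 < labelMass Q y → 0 < classCount z.2 y → 0 < classCount (z.1 t) y →
        lipDev (condLaw Q y) (classIdx z.2 y) (fun i => (z.2 i).1) +
          lipDev (condLaw (S t) y) (classIdx (z.1 t) y) (fun i => (z.1 t i).1) ≤
        kappa C s D T c δ (classCount (z.1 t) y) (classCount z.2 y)) ∧
      labelDev Q z.2 ≤ c * (1 / √M) + √(Real.log (1 / δ) / (2 * M)))} ⊆
      ((⋃ p : Fin T × {y : Y // 0 < labelMass Q y}, {z | z.1 p.1 ∈ bad (S p.1) (N p.1) p.2}) ∪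
        ⋃ y : {y : Y // 0 < labelMass Q y}, {z | z.2 ∈ bad Q M y}) ∪ {z | z.2 ∈ lab} := by
    intro z hz
    by_contra hcon
    simp only [Set.mem_union, Set.mem_iUnion, not_or, not_exists, Set.mem_ofPred_eq] at hcon
    refine hz ⟨fun t y hy hkQ hkS => ?_, not_lt.1 hcon.2⟩
    have h1 := hcon.1.1 (t, ⟨y, hy⟩)
    have h2 := hcon.1.2 ⟨y, hy⟩
    simp only [hbad, Set.mem_ofPred_eq, not_and, not_lt] at h1 h2
    have h3 := h1 (Finset.card_pos.1 hkS)
    have h4 := h2 (Finset.card_pos.1 hkQ)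
    have h5 : 1 / δ' = 2 * T * c / δ := by rw [hδ', one_div_div]
    simp only [hthr, h5] at h3 h4
    unfold kappa
    change _ ≤ C * ((classIdx (z.1 t) y).card : ℝ) ^ (-(1 / s)) +
      C * ((classIdx z.2 y).card : ℝ) ^ (-(1 / s)) + D * √(1 / 2 * Real.log (2 * T * c / δ)) *
      (√(1 / ((classIdx (z.1 t) y).card : ℝ)) + √(1 / ((classIdx z.2 y).card : ℝ)))
    linarith
  refine (measure_mono hsub).trans ?_
  have hcardle : (Fintype.card {y : Y // 0 < labelMass Q y} : ℝ) ≤ c := by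
    exact_mod_cast Fintype.card_subtype_le _
  have hb1 : dataLaw S Q N M (⋃ p : Fin T × {y : Y // 0 < labelMass Q y},
      {z | z.1 p.1 ∈ bad (S p.1) (N p.1) p.2}) ≤ ENNReal.ofReal (δ / 2) := by
    calc _ ≤ ∑ p : Fin T × {y : Y // 0 < labelMass Q y}, ENNReal.ofReal δ' :=
          (measure_iUnion_fintype_le _ _).trans (Finset.sum_le_sum fun p _ =>
            (dataLaw_preimage_source_le S Q N M p.1 _).trans (hbadle _ _ _
              (hne _ _ fun h => p.2.2.ne' (hSQ _ _ h))))
      _ = ENNReal.ofReal (T * Fintype.card {y : Y // 0 < labelMass Q y} * δ') := by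
          rw [← ENNReal.ofReal_sum_of_nonneg fun _ _ => hδ'0.le]
          simp
      _ ≤ ENNReal.ofReal (δ / 2) := by
          refine ENNReal.ofReal_le_ofReal ?_
          calc _ ≤ T * c * δ' := by gcongr
            _ = δ / 2 := by
              rw [hδ']
              field_simp
  have hb2 : dataLaw S Q N M (⋃ y : {y : Y // 0 < labelMass Q y}, {z | z.2 ∈ bad Q M y}) ≤
      ENNReal.ofReal (δ / 2) := by
    calc _ ≤ ∑ y : {y : Y // 0 < labelMass Q y}, ENNReal.ofReal δ' :=
          (measure_iUnion_fintype_le _ _).trans (Finset.sum_le_sum fun y _ =>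
            (dataLaw_preimage_target_le S Q N M _).trans (hbadle _ _ _ (hne _ _ y.2.ne')))
      _ = ENNReal.ofReal (Fintype.card {y : Y // 0 < labelMass Q y} * δ') := by
          rw [← ENNReal.ofReal_sum_of_nonneg fun _ _ => hδ'0.le]
          simp
      _ ≤ ENNReal.ofReal (δ / 2) := by
          refine ENNReal.ofReal_le_ofReal ?_
          calc _ ≤ 1 * c * δ' := by
                rw [one_mul]
                gcongr
            _ ≤ T * c * δ' := by gcongr
            _ = δ / 2 := by
              rw [hδ']
              field_simp
  have hb3 : dataLaw S Q N M {z | z.2 ∈ lab} ≤ ENNReal.ofReal δ :=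
    (dataLaw_preimage_target_le S Q N M _).trans (measure_labelDev_gt_le Q hM hδ hδ1.le)
  calc _ ≤ ENNReal.ofReal (δ / 2) + ENNReal.ofReal (δ / 2) + ENNReal.ofReal δ :=
        (measure_union_le _ _).trans (add_le_add ((measure_union_le _ _).trans
          (add_le_add hb1 hb2)) hb3)
    _ = ENNReal.ofReal (2 * δ) := by
        rw [← ENNReal.ofReal_add (by positivity) (by positivity),
          ← ENNReal.ofReal_add (by positivity) (by positivity)]
        congr 1
        ring

lemma maxEmpW1_bounds {D : ℝ} (hD : ∀ x y : X, dist x y ≤ D) (hD0 : 0 ≤ D) {N : Fin T → ℕ} {M : ℕ}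
    (zS : ∀ t, Fin (N t) → X × Y) (zQ : Fin M → X × Y)
    (hpos : ∀ y, 0 < labelMass Q y → 0 < classCount zQ y ∧ ∀ t, 0 < classCount (zS t) y) :
    0 ≤ maxEmpW1 Q zS zQ ∧ maxEmpW1 Q zS zQ ≤ D ∧
      ∀ t y, 0 < labelMass Q y → empW1 zQ (zS t) y ≤ maxEmpW1 Q zS zQ := by
  refine ⟨Real.iSup_nonneg fun p => ENNReal.toReal_nonneg, Real.iSup_le (fun p => ?_) hD0,
    fun t y hy => ?_⟩
  · have h := hpos _ p.2.2
    have := isProbabilityMeasure_empCond h.1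
    have := isProbabilityMeasure_empCond (h.2 p.1)
    exact ENNReal.toReal_le_of_le_ofReal hD0 (wasserstein1_le hD _ _)
  · exact le_ciSup (f := fun p : Fin T × {y : Y // 0 < labelMass Q y} => empW1 zQ (zS p.1) p.2)
      (Set.finite_range _).bddAbove (t, ⟨y, hy⟩)

end Concentration

end LabelShift

end

open LabelShift in
theorem theorem1 {d : ℕ} (X : Set (EuclideanSpace ℝ (Fin d))) (hX : Bornology.IsBounded X)
    (Y : Type*) [Fintype Y] [DecidableEq Y] [MeasurableSpace Y] [MeasurableSingletonClass Y] :
    -- the constants depend on the input space and the label space only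
    ∃ C s : ℝ, 0 < C ∧ 2 < s ∧
    ∀ (T : ℕ) (S : Fin T → Measure (X × Y)) (Q : Measure (X × Y))
      [∀ t, IsProbabilityMeasure (S t)] [IsProbabilityMeasure Q],
      -- the ratios `Q(y) / S t (y)` are finite
      (∀ t y, LabelShift.labelMass (S t) y = 0 → LabelShift.labelMass Q y = 0) →
    ∀ (ℓ : ℝ → ℝ) (L K : ℝ≥0) (Lmax : ℝ) (H : Set (X → Y → ℝ)),
      LipschitzWith L ℓ → (∀ a, 0 ≤ ℓ a ∧ ℓ a ≤ Lmax) →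
      (∀ h ∈ H, ∀ y, LipschitzWith K (fun x => h x y)) →
    ∀ δ : ℝ, 0 < δ → δ < 1 →
      -- the complexity term decreases when the sample sizes grow
      (∀ (Cmax : ℝ) (N N' : Fin T → ℕ) (M M' : ℕ) (k k' : Fin T → Y → ℕ) (m m' : Y → ℕ),
        0 ≤ Cmax → (∀ t, 0 < N t) → 0 < M →
        (∀ y, 0 < LabelShift.labelMass Q y → 0 < m y ∧ ∀ t, 0 < k t y) →
        N ≤ N' → M ≤ M' → k ≤ k' → m ≤ m' →
        LabelShift.comp S Q ℓ H (L * K) C s (Metric.diam X) Cmax N' M' k' m' δ ≤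
          LabelShift.comp S Q ℓ H (L * K) C s (Metric.diam X) Cmax N M k m δ) ∧
      -- the bound on the target risk
      ∀ (N : Fin T → ℕ) (M : ℕ), (∀ t, 0 < N t) → 0 < M →
      ∀ w ∈ stdSimplex ℝ (Fin T),
        ∃ E : Set ((∀ t, Fin (N t) → X × Y) × (Fin M → X × Y)),
          MeasurableSet E ∧ 1 - 4 * δ ≤ (LabelShift.dataLaw S Q N M).real E ∧
          ∀ z ∈ E,
            -- every class of the target occurs in each sample; otherwise `κ` is infinite
            (∀ y, 0 < LabelShift.labelMass Q y →
              0 < LabelShift.classCount z.2 y ∧ ∀ t, 0 < LabelShift.classCount (z.1 t) y) →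
            ∀ h ∈ H, ∀ αhat : Fin T → Y → ℝ,
              LabelShift.risk Q ℓ h ≤
                ∑ t, w t * LabelShift.empRisk (z.1 t) (αhat t) ℓ h +
                Lmax * (⨆ p : Fin T × Y, LabelShift.labelRatio (S p.1) Q p.2) *
                  √(∑ t, w t ^ 2 / ((N t : ℝ) / ∑ u, (N u : ℝ))) *
                  √(Real.log (1 / δ) / (2 * ∑ u, (N u : ℝ))) +
                L * K * ∑ t, w t * ∑ y,
                  ((LabelShift.classCount z.2 y : ℝ) / M) * LabelShift.empW1 z.2 (z.1 t) y +
                Lmax * (⨆ t, √(∑ y, (LabelShift.labelRatio (S t) Q y - αhat t y) ^ 2)) +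
                LabelShift.comp S Q ℓ H (L * K) C s (Metric.diam X)
                  (LabelShift.maxEmpW1 Q z.1 z.2) N M
                  (fun t y => LabelShift.classCount (z.1 t) y)
                  (fun y => LabelShift.classCount z.2 y) δ := by
  obtain ⟨R, hR0, hR⟩ := hX.exists_pos_norm_le
  set D := Metric.diam X with hDdef
  have hD0 : 0 ≤ D := Metric.diam_nonneg
  have hD : ∀ x y : X, dist x y ≤ D := fun x y => Metric.dist_le_diam_of_mem hX x.2 y.2
  set C₀ : ℝ := 2 * √d + D * (2 * R + 2) ^ d with hC₀
  have hC₀0 : 0 ≤ C₀ := by positivity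
  -- `C₀` comes from the grid bound and `D * |Y|` absorbs the mean label deviation; the `1` makes
  -- the constant positive. The exponent exceeds 2 even for `d = 0`.
  refine ⟨C₀ + D * Fintype.card Y + 1, 2 * d + 3, by positivity, ?_, ?_⟩
  · have : (0 : ℝ) ≤ d := d.cast_nonneg
    linarith
  intro T S Q _ _ hSQ ℓ L K Lmax H hℓL hℓ hH δ hδ hδ1
  -- With discrete labels the losses are continuous on `X × Y`, which gives measurability of the
  -- suprema over `H`.
  let _ : TopologicalSpace Y := ⊥
  have : DiscreteTopology Y := ⟨rfl⟩
  have hLmax : 0 ≤ Lmax := (hℓ 0).1.trans (hℓ 0).2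
  set α := ⨆ p : Fin T × Y, labelRatio (S p.1) Q p.2 with hα
  have hα0 : 0 ≤ α := Real.iSup_nonneg fun p => labelRatio_nonneg _ _ _
  have hαle : ∀ t y, labelRatio (S t) Q y ≤ α := fun t y =>
    le_ciSup (f := fun p : Fin T × Y => labelRatio (S p.1) Q p.2)
      (Set.finite_range _).bddAbove (t, y)
  set B : ℝ≥0 := ⟨Lmax * α, mul_nonneg hLmax hα0⟩ with hB
  set g : Fin T → H → X × Y → ℝ := fun t h p => labelRatio (S t) Q p.2 * ℓ (h.1 p.1 p.2) with hg
  have hfc : ∀ h ∈ H, Continuous fun p : X × Y => ℓ (h p.1 p.2) := fun h hh =>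
    hℓL.continuous.comp (continuous_prod_of_discrete_right.2 fun y => (hH h hh y).continuous)
  have hgc : ∀ t h, Continuous (g t h) := fun t h =>
    ((continuous_of_discreteTopology (f := labelRatio (S t) Q)).comp continuous_snd).mul
      (hfc h.1 h.2)
  have hgB : ∀ t h p, 0 ≤ g t h p ∧ g t h p ≤ B := fun t h p => by
    refine ⟨mul_nonneg (labelRatio_nonneg _ _ _) (hℓ _).1, ?_⟩
    change _ ≤ Lmax * α
    rw [mul_comm Lmax]
    exact mul_le_mul (hαle _ _) (hℓ _).2 (hℓ _).1 hα0
  have hgB' : ∀ t h p, |g t h p| ≤ B := fun t h p => by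
    rw [abs_of_nonneg (hgB t h p).1]
    exact (hgB t h p).2
  have hLK : (0 : ℝ) ≤ L * K := by positivity
  refine ⟨fun Cmax N N' M M' k k' m m' hCmax hN hM hpos hNN hMM hk hm =>
    comp_anti S Q (fun t => radComplexity_antitone (S t) (hgc t) (hgB' t) B.coe_nonneg (hN t) (hNN t))
      hLK (by positivity) (by positivity) hD0 hCmax hδ hδ1 hM hpos hMM hk hm, ?_⟩
  intro N M hN hM w hw
  -- An empty simplex has no point: weights summing to 1 force a source to exist.
  have hT : 0 < T := by
    rcases Nat.eq_zero_or_pos T with rfl | hT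
    · simpa using hw.2
    · exact hT
  have hT1 : (1 : ℝ) ≤ T := by exact_mod_cast hT
  have hbad := (measure_union_le _ _).trans (add_le_add
    ((dataLaw_preimage_sources_le S Q N M _).trans
      (measure_sum_uniformDev_gt_le S hgc hgB hN hw.1 hδ hδ1.le))
    (measure_class_or_label_deviation_le S Q hD hD0 hSQ (C := C₀) (s := 2 * d + 3)
      (fun μ _ n I ν _ hI hν => integral_lipDev_le hR hR0.le hD hD0 μ ν hI hν) N hM hT hδ hδ1))
  -- The bad set has measure at most `δ + 2δ`, which is below `4δ`.
  obtain ⟨E, hEm, hE, hEgood⟩ := exists_event_of_measure_le (dataLaw S Q N M)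
    (ε := 4 * δ) (by positivity) (hbad.trans (by
      rw [← ENNReal.ofReal_add hδ.le (by positivity)]
      exact ENNReal.ofReal_le_ofReal (by linarith)))
  refine ⟨E, hEm, hE, fun z hz hpos h hh αhat => ?_⟩
  have hgood := hEgood z hz
  simp only [Set.mem_union, Set.mem_preimage, Set.mem_ofPred_eq, not_or, not_lt, not_not] at hgood
  obtain ⟨hdev, hclass, hlab⟩ := hgood
  obtain ⟨hW0, hWD, hW⟩ := maxEmpW1_bounds Q hD hD0 z.1 z.2 hpos
  set Cmax := maxEmpW1 Q z.1 z.2 with hCmax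
  set κ := ⨆ p : Fin T × {y : Y // 0 < labelMass Q y},
    kappa (C₀ + D * Fintype.card Y + 1) (2 * d + 3) D T (Fintype.card Y) δ
      (classCount (z.1 p.1) p.2) (classCount z.2 p.2) with hκ
  have hgap : ∀ t, risk Q ℓ h - ∫ p, labelRatio (S t) Q p.2 * ℓ (h p.1 p.2) ∂(S t) ≤
      L * K * (∑ y, ((classCount z.2 y : ℝ) / M) * empW1 z.2 (z.1 t) y) +
        L * K * (κ + Cmax * √(Real.log (1 / δ) / (2 * M))) := fun t => by
    have := integral_sub_integral_ratio_le hD hD0 (S t) Q (hSQ t) (K := L * K)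
      (f := fun x y => ℓ (h x y)) (b := Lmax) (fun y => hℓL.comp (hH h hh y)) (hfc h hh).measurable
      (fun x y => by
        rw [abs_of_nonneg (hℓ _).1]
        exact (hℓ _).2)
      (zQ := z.2) (zS := z.1 t) (fun y hy => ⟨(hpos y hy).1, (hpos y hy).2 t⟩)
      (C := C₀) (s := 2 * d + 3) (κ := κ) (T := T) (δ := δ)
      (by have : (0 : ℝ) ≤ d := d.cast_nonneg
          linarith) hW0 (hW t) hWD
      (fun y hy => hclass t y hy (hpos y hy).1 ((hpos y hy).2 t))
      (fun y hy => le_ciSup (f := fun p : Fin T × {y : Y // 0 < labelMass Q y} =>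
        kappa (C₀ + D * Fintype.card Y + 1) (2 * d + 3) D T (Fintype.card Y) δ
          (classCount (z.1 p.1) p.2) (classCount z.2 p.2))
        (Set.finite_range _).bddAbove (t, ⟨y, hy⟩)) hlab
    rw [NNReal.coe_mul] at this
    exact this
  have hsrc : ∀ t, ∫ p, labelRatio (S t) Q p.2 * ℓ (h p.1 p.2) ∂(S t) ≤
      empRisk (z.1 t) (αhat t) ℓ h +
        Lmax * (⨆ t, √(∑ y, (labelRatio (S t) Q y - αhat t y) ^ 2)) +
        uniformDev (S t) (g t) (z.1 t) := fun t => by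
    have h1 := le_uniformDev (S t) (hgB' t) B.coe_nonneg (z.1 t) ⟨h, hh⟩
    have h2 := empRisk_le_add (hN t) (z.1 t) (labelRatio (S t) Q) (αhat t) hℓ h
    have h3 := mul_le_mul_of_nonneg_left
      (le_ciSup (f := fun t => √(∑ y, (labelRatio (S t) Q y - αhat t y) ^ 2))
        (Set.finite_range _).bddAbove t) hLmax
    change (∫ p, labelRatio (S t) Q p.2 * ℓ (h p.1 p.2) ∂(S t)) -
      empRisk (z.1 t) (labelRatio (S t) Q) ℓ h ≤ _ at h1
    linarith
  set Λ := Lmax * (⨆ t, √(∑ y, (labelRatio (S t) Q y - αhat t y) ^ 2)) with hΛ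
  set ρ := ⨆ t, rademacher (S t) (labelRatio (S t) Q) ℓ H (N t) with hρ
  have hrad : ∑ t, w t * (2 * radComplexity (S t) (g t) (N t)) ≤ 2 * ρ := by
    calc _ ≤ ∑ t, w t * (2 * ρ) := by
          refine Finset.sum_le_sum fun t _ => mul_le_mul_of_nonneg_left
            (mul_le_mul_of_nonneg_left ?_ zero_le_two) (hw.1 t)
          exact le_ciSup (f := fun t => rademacher (S t) (labelRatio (S t) Q) ℓ H (N t))
            (Set.finite_range _).bddAbove t
      _ = 2 * ρ := by rw [← Finset.sum_mul, hw.2, one_mul]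
  have hsum : risk Q ℓ h ≤ ∑ t, w t * (empRisk (z.1 t) (αhat t) ℓ h + Λ +
      uniformDev (S t) (g t) (z.1 t) +
      (L * K * (∑ y, ((classCount z.2 y : ℝ) / M) * empW1 z.2 (z.1 t) y) +
        L * K * (κ + Cmax * √(Real.log (1 / δ) / (2 * M))))) := by
    calc risk Q ℓ h = ∑ t, w t * risk Q ℓ h := by rw [← Finset.sum_mul, hw.2, one_mul]
      _ ≤ _ := Finset.sum_le_sum fun t _ => mul_le_mul_of_nonneg_left
          (by linarith [hgap t, hsrc t]) (hw.1 t)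
  simp only [mul_add, Finset.sum_add_distrib] at hsum
  simp only [← Finset.sum_mul, hw.2, one_mul] at hsum
  have hW' : ∑ t, w t * (L * K * ∑ y, ((classCount z.2 y : ℝ) / M) * empW1 z.2 (z.1 t) y) =
      L * K * ∑ t, w t * ∑ y, ((classCount z.2 y : ℝ) / M) * empW1 z.2 (z.1 t) y := by
    rw [Finset.mul_sum]
    exact Finset.sum_congr rfl fun t _ => by ring
  -- Only the McDiarmid fluctuation is left to cover, so `log (1/δ) ≤ log (T/δ)` suffices and the
  -- `log (2|Y|)` term is slack.
  have hlogs : Cmax * √(Real.log (1 / δ) / (2 * M)) ≤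
      Cmax * (√(2 * Real.log (2 * Fintype.card Y) / M) + √(Real.log (T / δ) / (2 * M))) := by
    refine mul_le_mul_of_nonneg_left ?_ hW0
    have h1 : √(Real.log (1 / δ) / (2 * M)) ≤ √(Real.log (T / δ) / (2 * M)) := by gcongr
    have h2 := Real.sqrt_nonneg (2 * Real.log (2 * Fintype.card Y) / M)
    linarith
  have hfin := mul_le_mul_of_nonneg_left hlogs hLK
  change _ ≤ _ + Lmax * α * _ * _ at hdev
  rw [hW'] at hsum
  unfold LabelShift.comp
  rw [mul_add (↑L * ↑K : ℝ)]
  linarith
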